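/- **Setting.** Consider a discounted Markov decision process with measurable state space $\mathcal S$, finite nonempty action space $\mathcal A$, transition kernel $P$, measurable reward $r$ with $|r|\le r_{\max}$, where $r_{\max}>0$, and discount factor $\gamma\in[0,1)$. For a (stationary Markov) policy $\pi$ let $Q^\pi(s,a)=(1-\gamma)\,\mathbb E_\pi[\sum_{t\ge0}\gamma^t r(s_t,a_t)\mid s_0=s,a_0=a]$, let $[\mathbb P^\pi g](s,a)=\mathbb E[g(s_1,a_1)]$ with $s_1\sim P(\cdot\mid s,a)$, $a_1\sim\pi(\cdot\mid s_1)$, and let $\mathbb T^\pi g=(1-\gamma)r+\gamma\mathbb P^\pi g$. Let $\pi^*$ be an optimal policy, i.e. $Q^{\pi^*}\ge Q^\pi$ pointwise for every policy $\pi$, and let $Q^*=Q^{\pi^*}$. For a policy $\pi$ with stationary state distribution $\nu_\pi$ write $\rho_\pi(s,a)=\nu_\pi(s)\pi(a\mid s)$, and write $\rho^*=\rho_{\pi^*}$; stationary state distributions are assumed to exist for $\pi^*$ and for all energy-based policies below. Let $\varphi:\mathcal S\times\mathcal A\to\mathbb R^d$ ($d>0$) be a measurable feature map with $\|\varphi\|_2\le1$,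 let $Q_\omega=\omega^\top\varphi$ and $f_\theta=\theta^\top\varphi$, and let $B(0,R)$ be the closed Euclidean ball of radius $R>0$, with Euclidean projection $\Gamma_R$ onto it. **Algorithm** (inputs $K$, $N\ge1$, $\beta$). The initial parameters $\theta_0,\omega_0$ are random with $\|\omega_0\|_2\le R$. Put $\tau_0=\infty$ and $\tau_k^{-1}=k/\beta$, and let $\pi_{\theta_k}\propto\exp(\tau_k^{-1}f_{\theta_k})$ and $\rho_k=\rho_{\pi_{\theta_k}}$. For $k=0,\dots,K$: 1. Actor: $\theta_{k+1}=\tau_{k+1}(\beta^{-1}\omega_k+\tau_k^{-1}\theta_k)$. 2. Critic: given the past, draw $N$ i.i.d. pairs $(s_{\ell,1},a_{\ell,1})\sim\rho_{k+1}$ and $N$ i.i.d. tuples with $(s_{\ell,2},a_{\ell,2})\sim\rho_{k+1}$, $r_{\ell,2}=r(s_{\ell,2},a_{\ell,2})$, $s'_{\ell,2}\sim P(\cdot\mid s_{\ell,2},a_{\ell,2})$, $a'_{\ell,2}\sim\pi_{\theta_{k+1}}(\cdot\mid s'_{\ell,2})$, and set $$\omega_{k+1}=\Gamma_R\Bigl\{\Bigl(\sum_{\ell=1}^N\varphi(s_{\ell,1},a_{\ell,1})\varphi(s_{\ell,1},a_{\ell,1})^\top\Bigr)^{-1}\sum_{\ell=1}^N\bigl((1-\gamma)r_{\ell,2}+\gamma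 Q_{\omega_k}(s'_{\ell,2},a'_{\ell,2})\bigr)\varphi(s_{\ell,2},a_{\ell,2})\Bigr\}$$ (if the first matrix is singular, its inverse is read as $0$). **Assumptions.** Let $\rho$ be a probability distribution on $\mathcal S\times\mathcal A$, and let $\phi^*,\sigma^*>0$. (A1) Concentrability. (i) Almost surely, $\rho^*\ll\rho_k$ and $\|d\rho^*/d\rho_k\|_{\rho_k,2}\le\phi^*$ for all $1\le k\le K+1$. (ii) For all $k\ge1$ and all policies $\pi_1,\dots,\pi_k$ we have $\rho\,\mathbb P^{\pi_1}\cdots\mathbb P^{\pi_k}\ll\rho^*$, and $C_{\rho,\rho^*}=(1-\gamma)^2\sum_{k\ge1}k^2\gamma^kc(k)<\infty$, where $c(k)=\sup_{\pi_1,\dots,\pi_k}\|d(\rho\mathbb P^{\pi_1}\cdots\mathbb P^{\pi_k})/d\rho^*\|_{\rho^*,\infty}$. (A2) Zero approximation error. For all $\omega,\theta\in B(0,R)$ and each temperature $\tau\in\{\tau_1,\dots,\tau_{K+1}\}$, the policy $\pi\propto\exp(\tau^{-1}f_\theta)$ satisfies $\inf_{\bar\omega\in B(0,R)}\mathbb E_{\rho_\pi}[(\mathbb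 T^\pi Q_\omega-\bar\omega^\top\varphi)^2]=0$. (A3) Well-conditioned features. Almost surely, the smallest singular value of $\mathbb E_{\rho_k}[\varphi\varphi^\top]$ is at least $\sigma^*$ for all $1\le k\le K+1$. **Theorem.** For all $\gamma\in[0,1)$, $r_{\max}>0$, $R>0$ and $c>0$ there are constants $C$ and $K_0$, depending only on these four numbers, such that the following holds for every process, feature map, distribution $\rho$ and constants $\phi^*,\sigma^*$ as above, every $\delta\in(0,1)$ and every $K\ge K_0$. Let $\beta=K^{1/2}$, let $$N\ \ge\ c\,K\,C_{\rho,\rho^*}^2\,(\phi^*/\sigma^*)^2\,\log^2(KN/\delta),$$ and suppose that (A1)–(A3) hold. Then the policies generated by the algorithm satisfy, with probability at least $1-\delta$, $$\mathbb E_{(s,a)\sim\rho}\Bigl[\sum_{k=0}^K\bigl(Q^*(s,a)-Q^{\pi_{\theta_{k+1}}}(s,a)\bigr)\Bigr]\ \le\ \bigl(2(1-\gamma)^{-3}\log|\mathcal A|+C\bigr)\,K^{1/2}.$$ -/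

import Mathlib

open MeasureTheory ProbabilityTheory
open scoped ENNReal RealInnerProductSpace

noncomputable section

namespace LinearAC

/-! ### Markov decision processes -/

/-- Transition kernel and (measurable) reward function of a Markov decision process with state
space `S` and action space `A`. -/
structure MDP (S A : Type*) [MeasurableSpace S] [MeasurableSpace A] where
  /-- transition kernel `P(· | s, a)` -/
  P : Kernel (S × A) S
  markov : IsMarkovKernel P
  /-- deterministic reward -/
  r : S × A → ℝ
  measurable_r : Measurable r

attribute [instance] MDP.markov

/-- A policy: a Markov kernel from states to actions. -/
abbrev Policy (S A : Type*) [MeasurableSpace S] [MeasurableSpace A] :=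
  {π : Kernel S A // IsMarkovKernel π}

instance {S A : Type*} [MeasurableSpace S] [MeasurableSpace A] (π : Policy S A) :
    IsMarkovKernel π.1 := π.2

section MDPDefs

variable {S A : Type*} [MeasurableSpace S] [MeasurableSpace A]

/-- The state-action transition `(s, a) ↦ (s₁, a₁)`, `s₁ ∼ P(· | s, a)`, `a₁ ∼ π(· | s₁)`. -/
def MDP.step (M : MDP S A) (π : Policy S A) : Kernel (S × A) (S × A) :=
  M.P ⊗ₖ (Kernel.prodMkLeft (S × A) π.1)

instance (M : MDP S A) (π : Policy S A) : IsMarkovKernel (M.step π) := by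
  unfold MDP.step; infer_instance

/-- The state transition `s ↦ s₁`, `a ∼ π(· | s)`, `s₁ ∼ P(· | s, a)`. -/
def MDP.stateStep (M : MDP S A) (π : Policy S A) : Kernel S S :=
  M.P ∘ₖ (Kernel.id ×ₖ π.1)

/-- Law of the trajectory `((s_t, a_t))_{t ≥ 0}` under `π` started from the pair `z = (s₀, a₀)`. -/
def MDP.traj (M : MDP S A) (π : Policy S A) (z : S × A) : Measure (ℕ → S × A) :=
  Kernel.traj (X := fun _ => S × A)
    (fun n => (M.step π).comap (fun h : (i : Finset.Iic n) → S × A => h ⟨n, by simp⟩)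
      (measurable_pi_apply _)) 0 (fun _ => z)

/-- The (normalized) action-value function
`Q^π(s, a) = (1 - γ) 𝔼_π[∑ₜ γᵗ r(s_t, a_t) | s₀ = s, a₀ = a]`. -/
def MDP.Q (M : MDP S A) (γ : ℝ) (π : Policy S A) (z : S × A) : ℝ :=
  (1 - γ) * ∫ x, ∑' t : ℕ, γ ^ t * M.r (x t) ∂(M.traj π z)

/-- `π` is optimal: its action-value function dominates that of every policy at every pair. -/
def MDP.IsOptimal (M : MDP S A) (γ : ℝ) (π : Policy S A) : Prop :=
  ∀ (π' : Policy S A) (z : S × A), M.Q γ π' z ≤ M.Q γ π z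

/-- The Bellman evaluation operator `𝕋^π g = (1 - γ) r + γ ℙ^π g`. -/
def MDP.bellman (M : MDP S A) (γ : ℝ) (π : Policy S A) (g : S × A → ℝ) (z : S × A) : ℝ :=
  (1 - γ) * M.r z + γ * ∫ z', g z' ∂(M.step π z)

/-- `ν` is a stationary state distribution of the policy `π`. -/
def MDP.IsStationary (M : MDP S A) (π : Policy S A) (ν : Measure S) : Prop :=
  IsProbabilityMeasure ν ∧ Kernel.Invariant (M.stateStep π) ν

/-- The state-action distribution `ρ(s, a) = ν(s) π(a | s)`. -/
def stateAction (ν : Measure S) (π : Policy S A) : Measure (S × A) := ν ⊗ₘ π.1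

/-- The future state-action distribution `ρ ℙ^{π₁} ⋯ ℙ^{π_k}` (with `π_{i+1} = π i`). -/
def MDP.future (M : MDP S A) (ρ : Measure (S × A)) (π : ℕ → Policy S A) : ℕ → Measure (S × A)
  | 0 => ρ
  | k + 1 => (M.future ρ π k).bind (M.step (π k))

/-- `c(k)`, the supremum over policies of `‖d(ρ ℙ^{π₁} ⋯ ℙ^{π_k}) / dρ*‖_{ρ*, ∞}`. -/
def MDP.conc (M : MDP S A) (ρ ρstar : Measure (S × A)) (k : ℕ) : ℝ≥0∞ :=
  ⨆ π : ℕ → Policy S A, eLpNorm ((M.future ρ π k).rnDeriv ρstar) ∞ ρstar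

/-- `C_{ρ, ρ*} = (1 - γ)² ∑_{k ≥ 1} k² γᵏ c(k)`. -/
def MDP.concCoeff (M : MDP S A) (γ : ℝ) (ρ ρstar : Measure (S × A)) : ℝ≥0∞ :=
  ENNReal.ofReal ((1 - γ) ^ 2) *
    ∑' k : ℕ, ENNReal.ofReal (((k + 1 : ℕ) : ℝ) ^ 2 * γ ^ (k + 1)) * M.conc ρ ρstar (k + 1)

/-- Concentrability of future state-action distributions: absolute continuity with respect to
`ρ*` and finiteness of `C_{ρ, ρ*}`. -/
def MDP.Concentrable (M : MDP S A) (γ : ℝ) (ρ ρstar : Measure (S × A)) : Prop :=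
  (∀ k : ℕ, 1 ≤ k → ∀ π : ℕ → Policy S A, M.future ρ π k ≪ ρstar) ∧
    M.concCoeff γ ρ ρstar < ∞

end MDPDefs

/-! ### Linear function approximation -/

/-- The parameter space `ℝᵈ` with its Euclidean norm. -/
abbrev Param (d : ℕ) := EuclideanSpace ℝ (Fin d)

/-- A measurable feature map `φ(s, a) ∈ ℝᵈ` with `‖φ(s, a)‖₂ ≤ 1`. -/
structure Feature (S A : Type*) [MeasurableSpace S] [MeasurableSpace A] (d : ℕ) where
  toFun : S × A → Param d
  measurable_toFun : Measurable toFun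
  norm_le_one : ∀ z, ‖toFun z‖ ≤ 1

section Linear

variable {S A : Type*} [MeasurableSpace S] [MeasurableSpace A] {d : ℕ}

/-- The linear function `(s, a) ↦ ωᵀ φ(s, a)`; it is both `Q_ω` and the energy `f_θ`. -/
def Feature.lin (φ : Feature S A d) (ω : Param d) (z : S × A) : ℝ := ⟪ω, φ.toFun z⟫

/-- `𝔼_ρ[φ φᵀ]`. -/
def Feature.cov (φ : Feature S A d) (ρ : Measure (S × A)) : Matrix (Fin d) (Fin d) ℝ :=
  Matrix.of fun i j => ∫ z, φ.toFun z i * φ.toFun z j ∂ρ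

/-- All singular values of the `d × d` matrix `G` (hence the smallest one) are at least `σ`. -/
def MinSingularValueGE (G : Matrix (Fin d) (Fin d) ℝ) (σ : ℝ) : Prop :=
  ∀ i < d, σ ≤ (Matrix.toEuclideanLin G).singularValues i

/-- Euclidean projection onto the centered closed ball of radius `R`. -/
def proj (R : ℝ) (x : Param d) : Param d := if ‖x‖ ≤ R then x else (R / ‖x‖) • x

lemma Feature.measurable_lin (φ : Feature S A d) (θ : Param d) : Measurable (φ.lin θ) := by
  have h := φ.measurable_toFun
  unfold Feature.lin
  fun_prop

section Policies

variable [Fintype A]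

/-- The probability that the energy-based policy `π(a | s) ∝ exp(η θᵀ φ(s, a))`, with inverse
temperature `η = τ⁻¹`, takes the action `a` at the state `s`. -/
def Feature.gibbs (φ : Feature S A d) (η : ℝ) (θ : Param d) (s : S) (a : A) : ℝ :=
  Real.exp (η * φ.lin θ (s, a)) / ∑ b : A, Real.exp (η * φ.lin θ (s, b))

lemma Feature.measurable_gibbs (φ : Feature S A d) (η : ℝ) (θ : Param d) (a : A) :
    Measurable fun s => φ.gibbs η θ s a := by
  have h : ∀ b : A, Measurable fun s : S => φ.lin θ (s, b) := fun b =>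
    (φ.measurable_lin θ).comp measurable_prodMk_right
  unfold Feature.gibbs
  fun_prop

lemma Feature.sum_gibbs [Nonempty A] (φ : Feature S A d) (η : ℝ) (θ : Param d) (s : S) :
    ∑ a : A, φ.gibbs η θ s a = 1 := by
  unfold Feature.gibbs
  rw [← Finset.sum_div]
  exact div_self (Finset.sum_pos (fun _ _ => Real.exp_pos _) Finset.univ_nonempty).ne'

variable [Nonempty A] [MeasurableSingletonClass A]

/-- The energy-based policy `π(· | s) ∝ exp(η θᵀ φ(s, ·))`, as a policy. -/
def Feature.policy (φ : Feature S A d) (η : ℝ) (θ : Param d) : Policy S A :=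
  ⟨{ toFun := fun s => ∑ a : A, ENNReal.ofReal (φ.gibbs η θ s a) • Measure.dirac a
     measurable' := by
      refine Measure.measurable_of_measurable_coe _ fun B hB => ?_
      have h := φ.measurable_gibbs η θ
      simp only [Measure.coe_finsetSum, Finset.sum_apply, Measure.smul_apply, smul_eq_mul]
      fun_prop },
    ⟨fun s => ⟨by
      simp only [Kernel.coe_mk, Measure.coe_finsetSum, Finset.sum_apply, Measure.smul_apply,
        measure_univ, smul_eq_mul, mul_one]
      rw [← ENNReal.ofReal_sum_of_nonneg, φ.sum_gibbs, ENNReal.ofReal_one]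
      intro a _
      unfold Feature.gibbs
      positivity⟩⟩⟩

/-- Zero approximation error for the energy-based policies `π_θ ∝ exp(τ_k⁻¹ f_θ)`, `θ ∈ B(0, R)`,
at the temperatures `τ_k = β / k`, `1 ≤ k ≤ K + 1`; here `ν π` is the stationary state
distribution of `π`. -/
def ZeroApproxError (M : MDP S A) (γ : ℝ) (φ : Feature S A d) (ν : Policy S A → Measure S)
    (R β : ℝ) (K : ℕ) : Prop :=
  ∀ k : ℕ, 1 ≤ k → k ≤ K + 1 → ∀ ω ∈ Metric.closedBall (0 : Param d) R,
    ∀ θ ∈ Metric.closedBall (0 : Param d) R,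
      ⨅ ω' : Metric.closedBall (0 : Param d) R,
        ∫ z, (M.bellman γ (φ.policy (k / β) θ) (φ.lin ω) z - φ.lin ω' z) ^ 2
          ∂(stateAction (ν (φ.policy (k / β) θ)) (φ.policy (k / β) θ)) = 0

/-- The sampled critic step before projection: from pairs `x_ℓ = (s_{ℓ,1}, a_{ℓ,1})` and
transitions `y_ℓ = ((s_{ℓ,2}, a_{ℓ,2}), (s'_{ℓ,2}, a'_{ℓ,2}))`,
`(∑ φ(x_ℓ) φ(x_ℓ)ᵀ)⁻¹ ∑ ((1 - γ) r + γ Q_ω(s'_{ℓ,2}, a'_{ℓ,2})) φ(s_{ℓ,2}, a_{ℓ,2})`. -/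
def criticStep (M : MDP S A) (γ : ℝ) (φ : Feature S A d) {N : ℕ} (ω : Param d)
    (x : Fin N → S × A) (y : Fin N → (S × A) × (S × A)) : Param d :=
  WithLp.toLp 2
    ((∑ l, Matrix.vecMulVec (φ.toFun (x l)).ofLp (φ.toFun (x l)).ofLp)⁻¹.mulVec
      (∑ l, ((1 - γ) * M.r (y l).1 + γ * φ.lin ω (y l).2) • (φ.toFun (y l).1).ofLp))

/-- A run of the linear actor-critic method with `K + 1` iterations, sample size `N`, temperature
parameter `β` and projection radius `R` on the probability space `(Ω, μ)`.

`θ k` and `ω k` are the actor and critic parameters, `τ_k⁻¹ = k / β` (so `τ_0 = ∞`), and the policy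
of iteration `k` is `φ.policy (k / β) (θ k)`. The batches `x k` and `y k` are those drawn in
iteration `k`, from the stationary distribution of the policy of iteration `k + 1`; `ℱ k`
contains the information available before they are drawn. -/
structure IsRun {Ω : Type*} {mΩ : MeasurableSpace Ω} (μ : Measure Ω) (ℱ : Filtration ℕ mΩ)
    (M : MDP S A) (γ : ℝ) (φ : Feature S A d) (ν : Policy S A → Measure S)
    (R β : ℝ) (K N : ℕ) (θ ω : ℕ → Ω → Param d)
    (x : ℕ → Ω → Fin N → S × A) (y : ℕ → Ω → Fin N → (S × A) × (S × A)) : Prop where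
  /-- random initialization, the critic being initialized in the ball -/
  init_actor : Measurable[ℱ 0] (θ 0)
  init_critic : Measurable[ℱ 0] (ω 0)
  init_ball : ∀ w, ‖ω 0 w‖ ≤ R
  /-- actor update `θ_{k+1} = τ_{k+1} (β⁻¹ ω_k + τ_k⁻¹ θ_k)` -/
  actor : ∀ k ≤ K, ∀ w,
    θ (k + 1) w = (β / ((k : ℝ) + 1)) • (β⁻¹ • ω k w + ((k : ℝ) / β) • θ k w)
  /-- the batches of iteration `k` are known after iteration `k` -/
  adapted_x : ∀ k ≤ K, Measurable[ℱ (k + 1)] (x k)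
  adapted_y : ∀ k ≤ K, Measurable[ℱ (k + 1)] (y k)
  /-- given the past, `(s_{ℓ,1}, a_{ℓ,1})`, `ℓ ≤ N`, are i.i.d. with law `ρ_{k+1}` -/
  law_x : ∀ k ≤ K, ∀ B : Set (Fin N → S × A), MeasurableSet B →
    μ⟦x k ⁻¹' B | ℱ k⟧ =ᵐ[μ] fun w =>
      let π := φ.policy (((k + 1 : ℕ) : ℝ) / β) (θ (k + 1) w)
      (Measure.pi fun _ : Fin N => stateAction (ν π) π).real B
  /-- given the past, `((s_{ℓ,2}, a_{ℓ,2}), (s'_{ℓ,2}, a'_{ℓ,2}))`, `ℓ ≤ N`, are i.i.d., with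
  `(s, a) ∼ ρ_{k+1}`, `s' ∼ P(· | s, a)` and `a' ∼ π_{θ_{k+1}}(· | s')` -/
  law_y : ∀ k ≤ K, ∀ B : Set (Fin N → (S × A) × (S × A)), MeasurableSet B →
    μ⟦y k ⁻¹' B | ℱ k⟧ =ᵐ[μ] fun w =>
      let π := φ.policy (((k + 1 : ℕ) : ℝ) / β) (θ (k + 1) w)
      (Measure.pi fun _ : Fin N => stateAction (ν π) π ⊗ₘ M.step π).real B
  /-- critic update -/
  critic : ∀ k ≤ K, ∀ w, ω (k + 1) w = proj R (criticStep M γ φ (ω k w) (x k w) (y k w))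

/-- Concentrability along the run: `ρ* ≪ ρ_k` and `‖dρ*/dρ_k‖_{ρ_k, 2} ≤ φ*`. -/
def ConcentrableAt (ρstar ρk : Measure (S × A)) (φstar : ℝ) : Prop :=
  ρstar ≪ ρk ∧ eLpNorm (ρstar.rnDeriv ρk) 2 ρk ≤ ENNReal.ofReal φstar

end Policies

end Linear

end LinearAC

end

noncomputable section

namespace LinearAC

/-- Bounded measurable real functions. -/
structure BddMeas {α : Type*} [MeasurableSpace α] (g : α → ℝ) : Prop where
  measurable : Measurable g
  bounded : ∃ C, ∀ z, |g z| ≤ C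

namespace BddMeas

variable {α : Type*} [MeasurableSpace α] {f g : α → ℝ}

lemma const (c : ℝ) : BddMeas fun _ : α => c := ⟨measurable_const, |c|, fun _ => le_rfl⟩

lemma add (hf : BddMeas f) (hg : BddMeas g) : BddMeas fun z => f z + g z := by
  obtain ⟨C, hC⟩ := hf.bounded
  obtain ⟨D, hD⟩ := hg.bounded
  exact ⟨hf.measurable.add hg.measurable, C + D, fun z =>
    (abs_add_le _ _).trans (add_le_add (hC z) (hD z))⟩

lemma const_mul (c : ℝ) (hf : BddMeas f) : BddMeas fun z => c * f z := by
  obtain ⟨C, hC⟩ := hf.bounded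
  exact ⟨hf.measurable.const_mul c, |c| * C, fun z => by
    rw [abs_mul]; exact mul_le_mul_of_nonneg_left (hC z) (abs_nonneg c)⟩

lemma sub (hf : BddMeas f) (hg : BddMeas g) : BddMeas fun z => f z - g z := by
  simpa [sub_eq_add_neg] using hf.add (hg.const_mul (-1))

lemma mul (hf : BddMeas f) (hg : BddMeas g) : BddMeas fun z => f z * g z := by
  obtain ⟨C, hC⟩ := hf.bounded
  obtain ⟨D, hD⟩ := hg.bounded
  exact ⟨hf.measurable.mul hg.measurable, C * D, fun z => by
    rw [abs_mul]
    exact mul_le_mul (hC z) (hD z) (abs_nonneg _) ((abs_nonneg _).trans (hC z))⟩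

lemma abs (hf : BddMeas f) : BddMeas fun z => |f z| := by
  obtain ⟨C, hC⟩ := hf.bounded
  exact ⟨hf.measurable.abs, C, fun z => by simpa using hC z⟩

lemma sum {ι : Type*} (s : Finset ι) {f : ι → α → ℝ} (hf : ∀ i ∈ s, BddMeas (f i)) :
    BddMeas fun z => ∑ i ∈ s, f i z := by
  classical
  induction s using Finset.induction_on with
  | empty => simpa using BddMeas.const (α := α) 0
  | insert a s ha ih =>
    simp only [Finset.sum_insert ha]
    exact (hf a (Finset.mem_insert_self a s)).add
      (ih fun i hi => hf i (Finset.mem_insert_of_mem hi))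

lemma comp {β : Type*} [MeasurableSpace β] (hf : BddMeas f) {h : β → α} (hh : Measurable h) :
    BddMeas fun b => f (h b) := by
  obtain ⟨C, hC⟩ := hf.bounded
  exact ⟨hf.measurable.comp hh, C, fun z => hC _⟩

lemma integrable (hf : BddMeas f) (μ : Measure α) [IsFiniteMeasure μ] : Integrable f μ := by
  obtain ⟨C, hC⟩ := hf.bounded
  exact Integrable.of_bound hf.measurable.aestronglyMeasurable C (ae_of_all _ fun z => hC z)

end BddMeas

lemma integral_le_of_le {α : Type*} [MeasurableSpace α] {f : α → ℝ} (hf : BddMeas f)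
    {μ : Measure α} [IsProbabilityMeasure μ] {C : ℝ} (h : ∀ z, f z ≤ C) : ∫ z, f z ∂μ ≤ C := by
  have := integral_mono (hf.integrable μ) (integrable_const C) h
  simpa using this

lemma abs_integral_le_of_abs_le {α : Type*} [MeasurableSpace α] {f : α → ℝ}
    {μ : Measure α} [IsProbabilityMeasure μ] {C : ℝ} (h : ∀ z, |f z| ≤ C) :
    |∫ z, f z ∂μ| ≤ C := by
  have := norm_integral_le_of_norm_le_const (μ := μ) (f := f) (ae_of_all _ h)
  simpa using this

section Operators

variable {S A : Type*} [MeasurableSpace S] [MeasurableSpace A]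

/-- The transition operator `[ℙ^π g](s, a) = 𝔼[g(s₁, a₁)]`. -/
def MDP.op (M : MDP S A) (π : Policy S A) (g : S × A → ℝ) (z : S × A) : ℝ :=
  ∫ z', g z' ∂(M.step π z)

variable (M : MDP S A) (π : Policy S A)

lemma MDP.bellman_eq (γ : ℝ) (g : S × A → ℝ) (z : S × A) :
    M.bellman γ π g z = (1 - γ) * M.r z + γ * M.op π g z := rfl

lemma MDP.abs_op_le {g : S × A → ℝ} {C : ℝ} (h : ∀ z, |g z| ≤ C) (z : S × A) :
    |M.op π g z| ≤ C := abs_integral_le_of_abs_le h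

lemma MDP.bddMeas_op {g : S × A → ℝ} (hg : BddMeas g) : BddMeas (M.op π g) := by
  obtain ⟨C, hC⟩ := hg.bounded
  refine ⟨?_, C, M.abs_op_le π hC⟩
  exact (hg.measurable.stronglyMeasurable.integral_kernel (κ := M.step π)).measurable

lemma MDP.bddMeas_bellman (hr : BddMeas M.r) (γ : ℝ) {g : S × A → ℝ} (hg : BddMeas g) :
    BddMeas (M.bellman γ π g) :=
  (hr.const_mul _).add ((M.bddMeas_op π hg).const_mul _)

lemma MDP.op_add {f g : S × A → ℝ} (hf : BddMeas f) (hg : BddMeas g) (z : S × A) :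
    M.op π (fun z => f z + g z) z = M.op π f z + M.op π g z :=
  integral_add (hf.integrable _) (hg.integrable _)

lemma MDP.op_sub {f g : S × A → ℝ} (hf : BddMeas f) (hg : BddMeas g) (z : S × A) :
    M.op π (fun z => f z - g z) z = M.op π f z - M.op π g z :=
  integral_sub (hf.integrable _) (hg.integrable _)

lemma MDP.op_sum {ι : Type*} (s : Finset ι) {f : ι → S × A → ℝ} (hf : ∀ i ∈ s, BddMeas (f i))
    (z : S × A) : M.op π (fun z => ∑ i ∈ s, f i z) z = ∑ i ∈ s, M.op π (f i) z :=
  integral_finsetSum s fun i hi => (hf i hi).integrable _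

lemma MDP.integral_bind_step {μ : Measure (S × A)} [IsProbabilityMeasure μ] {g : S × A → ℝ}
    (hg : BddMeas g) : ∫ z, g z ∂(μ.bind (M.step π)) = ∫ z, M.op π g z ∂μ := by
  rw [← Measure.snd_compProd, Measure.snd,
    integral_map measurable_snd.aemeasurable hg.measurable.aestronglyMeasurable,
    Measure.integral_compProd ((hg.comp measurable_snd).integrable _)]
  rfl

instance (z : S × A) : IsProbabilityMeasure (M.traj π z) := by
  unfold MDP.traj; infer_instance

lemma MDP.integral_traj_zero (g : S × A → ℝ) (hg : BddMeas g) (z : S × A) :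
    ∫ x, g (x 0) ∂(M.traj π z) = g z := by
  unfold MDP.traj
  rw [Kernel.integral_traj]
  · simp [Function.updateFinset]
  · exact (hg.measurable.comp (measurable_pi_apply 0)).aestronglyMeasurable

lemma MDP.integral_traj_succ (g : S × A → ℝ) (hg : BddMeas g) (z : S × A) (t : ℕ) :
    ∫ x, g (x (t + 1)) ∂(M.traj π z) = ∫ x, M.op π g (x t) ∂(M.traj π z) := by
  unfold MDP.traj
  set κ : (n : ℕ) → Kernel ((i : Finset.Iic n) → S × A) (S × A) := fun n =>
    (M.step π).comap (fun h : (i : Finset.Iic n) → S × A => h ⟨n, by simp⟩)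
      (measurable_pi_apply _) with hκ
  have key := Kernel.partialTraj_compProd_eq_map_traj (X := fun _ => S × A) (κ := κ)
    (Nat.zero_le t) (x₀ := fun _ => z)
  have h1 : ∫ x, g (x (t + 1)) ∂(Kernel.traj (X := fun _ => S × A) κ 0 fun _ => z)
      = ∫ p, g p.2 ∂((Kernel.traj (X := fun _ => S × A) κ 0 fun _ => z).map
          (fun x => (Preorder.frestrictLe t x, x (t + 1)))) := by
    exact (integral_map (φ := fun x : ℕ → S × A => (Preorder.frestrictLe t x, x (t + 1)))
      (f := fun p : ((i : Finset.Iic t) → S × A) × (S × A) => g p.2)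
      (Measurable.aemeasurable (by fun_prop))
      (hg.comp measurable_snd).measurable.aestronglyMeasurable).symm
  have h2 := Kernel.traj_map_frestrictLe_apply (X := fun _ => S × A) (κ := κ) 0 t (fun _ => z)
  rw [h1, ← key, Measure.integral_compProd ((hg.comp measurable_snd).integrable _), ← h2,
    integral_map (by fun_prop)]
  · rfl
  · exact (StronglyMeasurable.integral_kernel (κ := κ t)
      hg.measurable.stronglyMeasurable).aestronglyMeasurable

/-- The iterated transition operator applied to the reward. -/
def MDP.rewardAt (M : MDP S A) (π : Policy S A) (t : ℕ) : S × A → ℝ := (M.op π)^[t] M.r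

lemma MDP.rewardAt_succ (t : ℕ) : M.rewardAt π (t + 1) = M.op π (M.rewardAt π t) := by
  unfold MDP.rewardAt
  rw [Function.iterate_succ_apply']

variable {rmax : ℝ}

lemma MDP.bddMeas_r (hr : ∀ z, |M.r z| ≤ rmax) : BddMeas M.r := ⟨M.measurable_r, rmax, hr⟩

lemma MDP.bddMeas_rewardAt (hr : ∀ z, |M.r z| ≤ rmax) (t : ℕ) : BddMeas (M.rewardAt π t) := by
  induction t with
  | zero => exact M.bddMeas_r hr
  | succ t ih => rw [M.rewardAt_succ]; exact M.bddMeas_op π ih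

lemma MDP.abs_rewardAt_le (hr : ∀ z, |M.r z| ≤ rmax) (t : ℕ) :
    ∀ z, |M.rewardAt π t z| ≤ rmax := by
  induction t with
  | zero => exact hr
  | succ t ih => rw [M.rewardAt_succ]; exact M.abs_op_le π ih

lemma MDP.integral_traj_iterate (t : ℕ) (g : S × A → ℝ) (hg : BddMeas g)
    (z : S × A) : ∫ x, g (x t) ∂(M.traj π z) = (M.op π)^[t] g z := by
  induction t generalizing g with
  | zero => exact M.integral_traj_zero π g hg z
  | succ t ih =>
    rw [M.integral_traj_succ π g hg z t, ih _ (M.bddMeas_op π hg), Function.iterate_succ_apply]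

variable {γ : ℝ}

lemma summable_pow_mul_of_abs_le (hγ : 0 ≤ γ) (hγ1 : γ < 1) {u : ℕ → ℝ} {C : ℝ}
    (hu : ∀ t, |u t| ≤ C) : Summable fun t => γ ^ t * u t :=
  Summable.of_norm_bounded ((summable_geometric_of_lt_one hγ hγ1).mul_right C) fun t => by
    rw [norm_mul, norm_pow, Real.norm_of_nonneg hγ]
    exact mul_le_mul_of_nonneg_left (hu t) (pow_nonneg hγ t)

lemma MDP.Q_eq_tsum (hγ : 0 ≤ γ) (hγ1 : γ < 1) (hr : ∀ z, |M.r z| ≤ rmax) (z : S × A) :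
    M.Q γ π z = (1 - γ) * ∑' t : ℕ, γ ^ t * M.rewardAt π t z := by
  unfold MDP.Q
  congr 1
  have hm : ∀ t : ℕ, BddMeas fun x : ℕ → S × A => γ ^ t * M.r (x t) := fun t =>
    ((M.bddMeas_r hr).comp (measurable_pi_apply t)).const_mul _
  rw [← integral_tsum_of_summable_integral_norm (fun t => (hm t).integrable _)]
  · refine tsum_congr fun t => ?_
    rw [integral_const_mul, M.integral_traj_iterate π t _ (M.bddMeas_r hr)]
    rfl
  · refine Summable.of_nonneg_of_le (fun t => integral_nonneg fun x => norm_nonneg _) (fun t => ?_)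
      ((summable_geometric_of_lt_one hγ hγ1).mul_right rmax)
    refine integral_le_of_le (BddMeas.abs (hm t)) fun x => ?_
    rw [abs_mul, abs_of_nonneg (pow_nonneg hγ t)]
    exact mul_le_mul_of_nonneg_left (hr _) (pow_nonneg hγ t)

lemma MDP.abs_Q_le (hγ : 0 ≤ γ) (hγ1 : γ < 1) (hr : ∀ z, |M.r z| ≤ rmax) (z : S × A) :
    |M.Q γ π z| ≤ rmax := by
  rw [M.Q_eq_tsum π hγ hγ1 hr, abs_mul, abs_of_pos (sub_pos.2 hγ1)]
  have h : |∑' t : ℕ, γ ^ t * M.rewardAt π t z| ≤ (1 - γ)⁻¹ * rmax := by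
    rw [← Real.norm_eq_abs]
    refine tsum_of_norm_bounded ((hasSum_geometric_of_lt_one hγ hγ1).mul_right rmax) fun t => ?_
    rw [norm_mul, norm_pow, Real.norm_of_nonneg hγ]
    exact mul_le_mul_of_nonneg_left (M.abs_rewardAt_le π hr t z) (pow_nonneg hγ t)
  calc (1 - γ) * _ ≤ (1 - γ) * ((1 - γ)⁻¹ * rmax) :=
        mul_le_mul_of_nonneg_left h (sub_pos.2 hγ1).le
    _ = rmax := by rw [← mul_assoc, mul_inv_cancel₀ (sub_pos.2 hγ1).ne', one_mul]

lemma MDP.bddMeas_Q (hγ : 0 ≤ γ) (hγ1 : γ < 1) (hr : ∀ z, |M.r z| ≤ rmax) :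
    BddMeas (M.Q γ π) := by
  refine ⟨?_, rmax, M.abs_Q_le π hγ hγ1 hr⟩
  rw [funext (M.Q_eq_tsum π hγ hγ1 hr)]
  refine Measurable.const_mul ?_ _
  refine measurable_of_tendsto_metrizable
    (f := fun n z => ∑ t ∈ Finset.range n, γ ^ t * M.rewardAt π t z) (fun n => ?_) ?_
  · exact (BddMeas.sum _ fun t _ => (M.bddMeas_rewardAt π hr t).const_mul (γ ^ t)).measurable
  · rw [tendsto_pi_nhds]
    exact fun z => (summable_pow_mul_of_abs_le hγ hγ1
      fun t => M.abs_rewardAt_le π hr t z).hasSum.tendsto_sum_nat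

/-- The Bellman equation for the action-value function. -/
lemma MDP.bellman_Q (hγ : 0 ≤ γ) (hγ1 : γ < 1) (hr : ∀ z, |M.r z| ≤ rmax) (z : S × A) :
    M.bellman γ π (M.Q γ π) z = M.Q γ π z := by
  have hs := summable_pow_mul_of_abs_le hγ hγ1 fun t => M.abs_rewardAt_le π hr t z
  have hop : M.op π (M.Q γ π) z = (1 - γ) * ∑' t : ℕ, γ ^ t * M.rewardAt π (t + 1) z := by
    unfold MDP.op
    rw [funext (M.Q_eq_tsum π hγ hγ1 hr), integral_const_mul]
    congr 1
    rw [← integral_tsum_of_summable_integral_norm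
      (fun t => ((M.bddMeas_rewardAt π hr t).const_mul _).integrable _)]
    · refine tsum_congr fun t => ?_
      rw [integral_const_mul, M.rewardAt_succ]
      rfl
    · refine Summable.of_nonneg_of_le (fun t => integral_nonneg fun x => norm_nonneg _)
        (fun t => ?_) ((summable_geometric_of_lt_one hγ hγ1).mul_right rmax)
      refine integral_le_of_le
        (BddMeas.abs ((M.bddMeas_rewardAt π hr t).const_mul (γ ^ t))) fun x => ?_
      rw [abs_mul, abs_of_nonneg (pow_nonneg hγ t)]
      exact mul_le_mul_of_nonneg_left (M.abs_rewardAt_le π hr t _) (pow_nonneg hγ t)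
  rw [M.bellman_eq, hop, M.Q_eq_tsum π hγ hγ1 hr, hs.tsum_eq_zero_add]
  have : ∀ t, γ ^ (t + 1) * M.rewardAt π (t + 1) z = γ * (γ ^ t * M.rewardAt π (t + 1) z) :=
    fun t => by ring
  simp only [this, tsum_mul_left, pow_zero, one_mul]
  change (1 - γ) * M.rewardAt π 0 z + _ = _
  ring

end Operators

section Propagation

variable {S A : Type*} [MeasurableSpace S] [MeasurableSpace A]

lemma MDP.op_mono (M : MDP S A) (π : Policy S A) {f g : S × A → ℝ} (hf : BddMeas f)
    (hg : BddMeas g) (h : ∀ z, f z ≤ g z) (z : S × A) : M.op π f z ≤ M.op π g z :=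
  integral_mono (hf.integrable _) (hg.integrable _) h

lemma MDP.op_const (M : MDP S A) (π : Policy S A) (c : ℝ) (z : S × A) :
    M.op π (fun _ => c) z = c := by
  simp [MDP.op]

/-- The state-action distributions that can be reached from `ρ` in `m` steps. -/
def MDP.reach (M : MDP S A) (ρ : Measure (S × A)) (m : ℕ) : Set (Measure (S × A)) :=
  Set.range fun ϖ : ℕ → Policy S A => M.future ρ ϖ m

lemma MDP.future_congr (M : MDP S A) (ρ : Measure (S × A)) {ϖ ϖ' : ℕ → Policy S A} (m : ℕ)
    (h : ∀ i < m, ϖ i = ϖ' i) : M.future ρ ϖ m = M.future ρ ϖ' m := by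
  induction m with
  | zero => rfl
  | succ m ih =>
    simp only [MDP.future]
    rw [ih fun i hi => h i (hi.trans m.lt_succ_self), h m m.lt_succ_self]

lemma MDP.bind_mem_reach (M : MDP S A) {ρ μ : Measure (S × A)} {m : ℕ} (hμ : μ ∈ M.reach ρ m)
    (π : Policy S A) : μ.bind (M.step π) ∈ M.reach ρ (m + 1) := by
  obtain ⟨ϖ, rfl⟩ := hμ
  refine ⟨Function.update ϖ m π, ?_⟩
  simp only [MDP.future, Function.update_self]
  rw [M.future_congr ρ (ϖ := Function.update ϖ m π) (ϖ' := ϖ) m]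
  intro i hi
  simp [hi.ne]

lemma MDP.isProbabilityMeasure_of_mem_reach (M : MDP S A) {ρ : Measure (S × A)}
    [IsProbabilityMeasure ρ] {m : ℕ} {μ : Measure (S × A)} (hμ : μ ∈ M.reach ρ m) :
    IsProbabilityMeasure μ := by
  obtain ⟨ϖ, rfl⟩ := hμ
  induction m with
  | zero => simpa [MDP.future]
  | succ m ih => simp only [MDP.future]; infer_instance

lemma MDP.self_mem_reach (M : MDP S A) (ρ : Measure (S × A)) [Nonempty (Policy S A)] :
    ρ ∈ M.reach ρ 0 := ⟨fun _ => Classical.arbitrary _, rfl⟩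

/-- The error made in the `k`-th approximate policy evaluation. -/
def MDP.residual (M : MDP S A) (γ : ℝ) (π : ℕ → Policy S A) (q : ℕ → S × A → ℝ) (k : ℕ)
    (z : S × A) : ℝ := q (k + 1) z - M.bellman γ (π (k + 1)) (q k) z

variable {M : MDP S A} {γ rmax : ℝ} {ρ : Measure (S × A)} [IsProbabilityMeasure ρ]
  {π : ℕ → Policy S A} {q : ℕ → S × A → ℝ} {K : ℕ} {c T T' : ℕ → ℝ} {η : ℝ}

lemma MDP.bddMeas_residual (hr : ∀ z, |M.r z| ≤ rmax) (hq : ∀ k, BddMeas (q k)) (k : ℕ) :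
    BddMeas (M.residual γ π q k) :=
  (hq _).sub (M.bddMeas_bellman _ (M.bddMeas_r hr) γ (hq k))

/-- The cumulative gap between the comparator and the evaluation targets. -/
lemma MDP.integral_sum_gap_le (hγ : 0 ≤ γ) (hγ1 : γ < 1) (hr : ∀ z, |M.r z| ≤ rmax)
    (hq : ∀ k, BddMeas (q k)) (πs : Policy S A) {B D : ℝ} (hB0 : 0 ≤ B) (hD0 : 0 ≤ D)
    (hB : ∀ z, M.Q γ πs z - q 0 z ≤ B)
    (hD : ∀ n ≤ K, ∀ z,
      ∑ k ∈ Finset.range (n + 1), (M.op πs (q k) z - M.op (π (k + 1)) (q k) z) ≤ D)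
    (hη : 0 ≤ η) (hT0 : ∀ m, 1 ≤ m → 0 ≤ T m) (hT : ∀ m, 1 ≤ m → T m = c m + γ * T (m + 1))
    (herr : ∀ k ≤ K, ∀ m, 1 ≤ m → ∀ μ ∈ M.reach ρ m,
      ∫ z, |M.residual γ π q k z| ∂μ ≤ c m * η)
    (n : ℕ) (hn : n ≤ K + 1) (m : ℕ) (μ : Measure (S × A)) (hμ : μ ∈ M.reach ρ m) :
    ∫ z, ∑ k ∈ Finset.range n, (M.Q γ πs z - M.bellman γ (π (k + 1)) (q k) z) ∂μ
      ≤ γ * (B + D) / (1 - γ) + n * η * (γ * T (m + 1)) := by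
  have h1γ : 0 < 1 - γ := sub_pos.2 hγ1
  have hQ := M.bddMeas_Q πs hγ hγ1 hr
  have hb : ∀ k, BddMeas (M.bellman γ (π (k + 1)) (q k)) := fun k =>
    M.bddMeas_bellman _ (M.bddMeas_r hr) γ (hq k)
  have hG : ∀ n, BddMeas fun z =>
      ∑ k ∈ Finset.range n, (M.Q γ πs z - M.bellman γ (π (k + 1)) (q k) z) := fun n =>
    BddMeas.sum _ fun k _ => hQ.sub (hb k)
  have hE : ∀ n, BddMeas fun z => ∑ k ∈ Finset.range n, |M.residual γ π q k z| := fun n =>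
    BddMeas.sum _ fun k _ => (M.bddMeas_residual hr hq k).abs
  induction n generalizing m μ with
  | zero =>
    simp only [Finset.range_zero, Finset.sum_empty, integral_zero, Nat.cast_zero, zero_mul,
      add_zero]
    positivity
  | succ n ih =>
    have := M.isProbabilityMeasure_of_mem_reach hμ
    have hμ' := M.bind_mem_reach hμ πs
    have := M.isProbabilityMeasure_of_mem_reach hμ'
    set g : S × A → ℝ := fun z =>
      (∑ k ∈ Finset.range n, (M.Q γ πs z - M.bellman γ (π (k + 1)) (q k) z)) +
        ∑ k ∈ Finset.range n, |M.residual γ π q k z| with hg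
    have hgm : BddMeas g := (hG n).add (hE n)
    have hpt : ∀ z, ∑ k ∈ Finset.range (n + 1),
        (M.Q γ πs z - M.bellman γ (π (k + 1)) (q k) z) ≤ γ * (B + D) + γ * M.op πs g z := by
      intro z
      have e1 : ∀ k, M.Q γ πs z - M.bellman γ (π (k + 1)) (q k) z
          = γ * ((M.op πs (q k) z - M.op (π (k + 1)) (q k) z) +
            (M.op πs (fun z => M.Q γ πs z - q k z) z)) := by
        intro k
        rw [M.op_sub πs hQ (hq k)]
        nth_rewrite 1 [← M.bellman_Q πs hγ hγ1 hr z]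
        rw [M.bellman_eq, M.bellman_eq]
        ring
      rw [Finset.sum_congr rfl fun k _ => e1 k, ← Finset.mul_sum, Finset.sum_add_distrib,
        ← M.op_sum πs _ (fun k _ => hQ.sub (hq k)), ← mul_add]
      refine mul_le_mul_of_nonneg_left ?_ hγ
      have e2 : M.op πs (fun z => ∑ k ∈ Finset.range (n + 1), (M.Q γ πs z - q k z)) z
          ≤ M.op πs (fun z => B + g z) z := by
        refine M.op_mono πs (BddMeas.sum _ fun k _ => hQ.sub (hq k))
          ((BddMeas.const B).add hgm) (fun z => ?_) z
        rw [Finset.sum_range_succ', add_comm, hg]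
        refine add_le_add (hB z) ?_
        simp only
        rw [← Finset.sum_add_distrib]
        refine Finset.sum_le_sum fun k _ => ?_
        have := neg_le_abs (M.residual γ π q k z)
        simp only [MDP.residual] at this ⊢
        linarith
      rw [M.op_add πs (BddMeas.const B) hgm, M.op_const] at e2
      linarith [hD n (by omega) z]
    have hint := integral_mono ((hG (n + 1)).integrable μ)
      (((BddMeas.const (γ * (B + D))).add ((M.bddMeas_op πs hgm).const_mul γ)).integrable μ) hpt
    rw [integral_add ((BddMeas.const _).integrable μ)
      (((M.bddMeas_op πs hgm).const_mul γ).integrable μ), integral_const_mul γ (M.op πs g),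
      ← M.integral_bind_step πs hgm, integral_add ((hG n).integrable _) ((hE n).integrable _),
      integral_finsetSum _ fun k _ => (M.bddMeas_residual hr hq k).abs.integrable _] at hint
    have hsum : ∑ k ∈ Finset.range n, ∫ z, |M.residual γ π q k z| ∂(μ.bind (M.step πs))
        ≤ n * (c (m + 1) * η) := by
      refine (Finset.sum_le_sum fun k hk =>
        herr k (by have := Finset.mem_range.1 hk; omega) (m + 1) (by omega) _ hμ').trans ?_
      simp
    have hih := ih (by omega) (m + 1) _ hμ'
    have hTm := hT (m + 1) (by omega)
    have hTm0 := hT0 (m + 1) (by omega)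
    simp only [integral_const, probReal_univ, smul_eq_mul, one_mul] at hint
    refine hint.trans ?_
    have step : γ * (∫ z, ∑ k ∈ Finset.range n, (M.Q γ πs z - M.bellman γ (π (k + 1)) (q k) z)
          ∂(μ.bind (M.step πs)) +
        ∑ k ∈ Finset.range n, ∫ z, |M.residual γ π q k z| ∂(μ.bind (M.step πs)))
        ≤ γ * (γ * (B + D) / (1 - γ) + n * η * (γ * T (m + 1 + 1)) + n * (c (m + 1) * η)) :=
      mul_le_mul_of_nonneg_left (add_le_add hih hsum) hγ
    have e3 : γ * (B + D) + γ * (γ * (B + D) / (1 - γ) + n * η * (γ * T (m + 1 + 1))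
        + n * (c (m + 1) * η)) = γ * (B + D) / (1 - γ) + n * η * (γ * T (m + 1)) := by
      rw [hTm]; field_simp; ring
    have e4 : n * η * (γ * T (m + 1)) ≤ (n + 1 : ℕ) * η * (γ * T (m + 1)) := by
      push_cast
      have : 0 ≤ η * (γ * T (m + 1)) := by positivity
      nlinarith
    linarith

/-- The Bellman residuals `Q_k - 𝕋^{π_{k+1}} Q_k` contract. -/
lemma MDP.integral_bellman_gap_le (hγ : 0 ≤ γ) (hr : ∀ z, |M.r z| ≤ rmax)
    (hq : ∀ k, BddMeas (q k)) {B : ℝ}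
    (hB : ∀ z, q 0 z - M.bellman γ (π 1) (q 0) z ≤ B)
    (himp : ∀ k, 1 ≤ k → k ≤ K → ∀ z, M.op (π k) (q k) z ≤ M.op (π (k + 1)) (q k) z)
    (hη : 0 ≤ η) (hT0 : ∀ m, 1 ≤ m → 0 ≤ T m) (hT : ∀ m, 1 ≤ m → T m = c m + γ * T (m + 1))
    (herr : ∀ k ≤ K, ∀ m, 1 ≤ m → ∀ μ ∈ M.reach ρ m,
      ∫ z, |M.residual γ π q k z| ∂μ ≤ c m * η)
    (k : ℕ) (hk : k ≤ K) (m : ℕ) (hm : 1 ≤ m) (μ : Measure (S × A)) (hμ : μ ∈ M.reach ρ m) :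
    ∫ z, (q k z - M.bellman γ (π (k + 1)) (q k) z) ∂μ
      ≤ γ ^ k * B + η * (T m + γ * T (m + 1)) := by
  have hb : ∀ k, BddMeas fun z => q k z - M.bellman γ (π (k + 1)) (q k) z := fun k =>
    (hq k).sub (M.bddMeas_bellman _ (M.bddMeas_r hr) γ (hq k))
  have hres := M.bddMeas_residual (γ := γ) (π := π) hr hq
  induction k generalizing m μ with
  | zero =>
    have := M.isProbabilityMeasure_of_mem_reach hμ
    have h1 := hT0 m hm
    have h2 := hT0 (m + 1) (by omega)
    have h3 := integral_le_of_le (μ := μ) (hb 0) hB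
    have : 0 ≤ η * (T m + γ * T (m + 1)) := by positivity
    simp only [zero_add] at h3 ⊢
    linarith
  | succ k ih =>
    have := M.isProbabilityMeasure_of_mem_reach hμ
    have hμ' := M.bind_mem_reach hμ (π (k + 1))
    have := M.isProbabilityMeasure_of_mem_reach hμ'
    have hgm := (hb k).add (hres k).abs
    have hpt : ∀ z, q (k + 1) z - M.bellman γ (π (k + 1 + 1)) (q (k + 1)) z
        ≤ γ * M.op (π (k + 1)) (fun z => (q k z - M.bellman γ (π (k + 1)) (q k) z) +
          |M.residual γ π q k z|) z + |M.residual γ π q k z| := by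
      intro z
      have h1 := himp (k + 1) (by omega) hk z
      have h2 : M.op (π (k + 1)) (q k) z - M.op (π (k + 1)) (q (k + 1)) z ≤
          M.op (π (k + 1)) (fun z => (q k z - M.bellman γ (π (k + 1)) (q k) z) +
          |M.residual γ π q k z|) z := by
        rw [← M.op_sub _ (hq k) (hq (k + 1))]
        refine M.op_mono _ ((hq k).sub (hq (k + 1))) hgm (fun z => ?_) z
        have := neg_le_abs (M.residual γ π q k z)
        simp only [MDP.residual] at this ⊢
        linarith
      have h3 := le_abs_self (M.residual γ π q k z)
      have h4 : q (k + 1) z = M.residual γ π q k z + M.bellman γ (π (k + 1)) (q k) z := by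
        simp [MDP.residual]
      rw [h4, M.bellman_eq, M.bellman_eq]
      nlinarith [mul_le_mul_of_nonneg_left h1 hγ, mul_le_mul_of_nonneg_left h2 hγ]
    have hint := integral_mono ((hb (k + 1)).integrable μ)
      ((((M.bddMeas_op (π (k + 1)) hgm).const_mul γ).add (hres k).abs).integrable μ) hpt
    rw [integral_add (((M.bddMeas_op (π (k + 1)) hgm).const_mul γ).integrable μ)
      ((hres k).abs.integrable μ), integral_const_mul, ← M.integral_bind_step _ hgm,
      integral_add ((hb k).integrable _) ((hres k).abs.integrable _)] at hint
    have h5 := herr k (by omega) m hm μ hμ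
    have h6 := herr k (by omega) (m + 1) (by omega) _ hμ'
    have h7 := ih (by omega) (m + 1) (by omega) _ hμ'
    refine hint.trans ?_
    have h8 := mul_le_mul_of_nonneg_left (add_le_add h7 h6) hγ
    have h9 : γ * (γ ^ k * B + η * (T (m + 1) + γ * T (m + 1 + 1)) + c (m + 1) * η) + c m * η
        = γ ^ (k + 1) * B + η * (T m + γ * T (m + 1)) := by
      rw [hT m hm]
      nth_rewrite 3 [hT (m + 1) (by omega)]
      ring
    linarith

/-- The gap between the evaluation target and the action-value function of the policy. -/
lemma MDP.integral_evaluation_gap_le (hγ : 0 ≤ γ) (hγ1 : γ < 1) (hr : ∀ z, |M.r z| ≤ rmax)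
    (p : Policy S A) {g : S × A → ℝ} (hg : BddMeas g) {b : ℝ} (hb0 : 0 ≤ b)
    (hη : 0 ≤ η) (hT'0 : ∀ m, 1 ≤ m → 0 ≤ T' m)
    (hT' : ∀ m, 1 ≤ m → T' m = T m + γ * T' (m + 1))
    (hgap : ∀ m, 1 ≤ m → ∀ μ ∈ M.reach ρ m,
      ∫ z, (g z - M.bellman γ p g z) ∂μ ≤ b + η * (T m + γ * T (m + 1)))
    (m : ℕ) (μ : Measure (S × A)) (hμ : μ ∈ M.reach ρ m) :
    ∫ z, (M.bellman γ p g z - M.Q γ p z) ∂μ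
      ≤ γ * b / (1 - γ) + η * (γ * T' (m + 1) + γ ^ 2 * T' (m + 2)) := by
  have h1γ : 0 < 1 - γ := sub_pos.2 hγ1
  have hQ := M.bddMeas_Q p hγ hγ1 hr
  have hbg := M.bddMeas_bellman p (M.bddMeas_r hr) γ hg
  have hh : BddMeas fun z => M.bellman γ p g z - M.Q γ p z := hbg.sub hQ
  have he : BddMeas fun z => g z - M.bellman γ p g z := hg.sub hbg
  obtain ⟨H, hH⟩ := hh.bounded
  have key : ∀ n m, ∀ μ ∈ M.reach ρ m, ∫ z, (M.bellman γ p g z - M.Q γ p z) ∂μ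
      ≤ γ * b / (1 - γ) + η * (γ * T' (m + 1) + γ ^ 2 * T' (m + 2)) + γ ^ n * H := by
    intro n
    induction n with
    | zero =>
      intro m μ hμ
      have := M.isProbabilityMeasure_of_mem_reach hμ
      have h3 := integral_le_of_le (μ := μ) hh fun z => (le_abs_self _).trans (hH z)
      have h1 := hT'0 (m + 1) (by omega)
      have h2 := hT'0 (m + 2) (by omega)
      have : 0 ≤ γ * b / (1 - γ) + η * (γ * T' (m + 1) + γ ^ 2 * T' (m + 2)) := by positivity
      simp only [pow_zero, one_mul]
      linarith
    | succ n ih =>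
      intro m μ hμ
      have := M.isProbabilityMeasure_of_mem_reach hμ
      have hμ' := M.bind_mem_reach hμ p
      have := M.isProbabilityMeasure_of_mem_reach hμ'
      have hpt : ∀ z, M.bellman γ p g z - M.Q γ p z
          = γ * M.op p (fun z => (g z - M.bellman γ p g z) +
            (M.bellman γ p g z - M.Q γ p z)) z := by
        intro z
        have : (fun z => (g z - M.bellman γ p g z) + (M.bellman γ p g z - M.Q γ p z))
            = fun z => g z - M.Q γ p z := by ext z; ring
        rw [this, M.op_sub p hg hQ]
        nth_rewrite 1 [← M.bellman_Q p hγ hγ1 hr z]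
        rw [M.bellman_eq, M.bellman_eq]
        ring
      rw [integral_congr_ae (ae_of_all _ hpt), integral_const_mul,
        ← M.integral_bind_step p (he.add hh), integral_add (he.integrable _) (hh.integrable _)]
      have h1 := hgap (m + 1) (by omega) _ hμ'
      have h2 := ih (m + 1) _ hμ'
      refine (mul_le_mul_of_nonneg_left (add_le_add h1 h2) hγ).trans (le_of_eq ?_)
      rw [hT' (m + 1) (by omega), hT' (m + 2) (by omega)]
      field_simp
      ring
  have hlim : Filter.Tendsto (fun n : ℕ =>
      γ * b / (1 - γ) + η * (γ * T' (m + 1) + γ ^ 2 * T' (m + 2)) + γ ^ n * H) Filter.atTop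
      (nhds (γ * b / (1 - γ) + η * (γ * T' (m + 1) + γ ^ 2 * T' (m + 2)) + 0 * H)) :=
    ((tendsto_pow_atTop_nhds_zero_of_lt_one hγ hγ1).mul_const H).const_add _
  rw [zero_mul, add_zero] at hlim
  exact ge_of_tendsto' hlim fun n => key n m μ hμ

/-- Cumulative performance gap of approximate policy iteration in terms of the regret bound `D`
of the policy updates and of the evaluation errors. -/
lemma MDP.integral_sum_Q_sub_Q_le (hγ : 0 ≤ γ) (hγ1 : γ < 1) (hr : ∀ z, |M.r z| ≤ rmax)
    (hq : ∀ k, BddMeas (q k)) (πs : Policy S A) {B D : ℝ} (hB0 : 0 ≤ B) (hD0 : 0 ≤ D)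
    (hB : ∀ z, M.Q γ πs z - q 0 z ≤ B)
    (hB' : ∀ z, q 0 z - M.bellman γ (π 1) (q 0) z ≤ B)
    (hD : ∀ n ≤ K, ∀ z,
      ∑ k ∈ Finset.range (n + 1), (M.op πs (q k) z - M.op (π (k + 1)) (q k) z) ≤ D)
    (himp : ∀ k, 1 ≤ k → k ≤ K → ∀ z, M.op (π k) (q k) z ≤ M.op (π (k + 1)) (q k) z)
    (hη : 0 ≤ η) (hT0 : ∀ m, 1 ≤ m → 0 ≤ T m) (hT : ∀ m, 1 ≤ m → T m = c m + γ * T (m + 1))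
    (hT'0 : ∀ m, 1 ≤ m → 0 ≤ T' m) (hT' : ∀ m, 1 ≤ m → T' m = T m + γ * T' (m + 1))
    (herr : ∀ k ≤ K, ∀ m, 1 ≤ m → ∀ μ ∈ M.reach ρ m,
      ∫ z, |M.residual γ π q k z| ∂μ ≤ c m * η) :
    ∫ z, ∑ k ∈ Finset.range (K + 1), (M.Q γ πs z - M.Q γ (π (k + 1)) z) ∂ρ
      ≤ γ * (B + D) / (1 - γ) + γ * B / (1 - γ) ^ 2 +
        (K + 1) * η * (γ * T 1 + γ * T' 1 + γ ^ 2 * T' 2) := by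
  have h1γ : 0 < 1 - γ := sub_pos.2 hγ1
  have hne : Nonempty (Policy S A) := ⟨πs⟩
  have hQ : ∀ p, BddMeas (M.Q γ p) := fun p => M.bddMeas_Q p hγ hγ1 hr
  have hb : ∀ k, BddMeas (M.bellman γ (π (k + 1)) (q k)) := fun k =>
    M.bddMeas_bellman _ (M.bddMeas_r hr) γ (hq k)
  have hG := M.integral_sum_gap_le hγ hγ1 hr hq πs hB0 hD0 hB hD hη hT0 hT herr (K + 1) le_rfl 0 ρ
    (M.self_mem_reach ρ)
  have hh : ∀ k ∈ Finset.range (K + 1),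
      ∫ z, (M.bellman γ (π (k + 1)) (q k) z - M.Q γ (π (k + 1)) z) ∂ρ
      ≤ γ * (γ ^ k * B) / (1 - γ) + η * (γ * T' 1 + γ ^ 2 * T' 2) := by
    intro k hk
    have hk' : k ≤ K := by have := Finset.mem_range.1 hk; omega
    exact M.integral_evaluation_gap_le hγ hγ1 hr (π (k + 1)) (hq k) (by positivity) hη hT'0 hT'
      (M.integral_bellman_gap_le hγ hr hq hB' himp hη hT0 hT herr k hk') 0 ρ (M.self_mem_reach ρ)
  have hgeom : ∑ k ∈ Finset.range (K + 1), γ ^ k ≤ (1 - γ)⁻¹ := by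
    rw [← tsum_geometric_of_lt_one hγ hγ1]
    exact (summable_geometric_of_lt_one hγ hγ1).sum_le_tsum _ fun k _ => pow_nonneg hγ k
  have hsplit : ∫ z, ∑ k ∈ Finset.range (K + 1), (M.Q γ πs z - M.Q γ (π (k + 1)) z) ∂ρ
      = ∫ z, ∑ k ∈ Finset.range (K + 1), (M.Q γ πs z - M.bellman γ (π (k + 1)) (q k) z) ∂ρ
        + ∑ k ∈ Finset.range (K + 1),
          ∫ z, (M.bellman γ (π (k + 1)) (q k) z - M.Q γ (π (k + 1)) z) ∂ρ := by
    rw [← integral_finsetSum _ fun k _ => ((hb k).sub (hQ _)).integrable _,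
      ← integral_add ((BddMeas.sum _ fun k _ => (hQ πs).sub (hb k)).integrable _)
        ((BddMeas.sum _ fun k _ => (hb k).sub (hQ _)).integrable _)]
    refine integral_congr_ae (ae_of_all _ fun z => ?_)
    simp only
    rw [← Finset.sum_add_distrib]
    exact Finset.sum_congr rfl fun k _ => by ring
  rw [hsplit]
  refine (add_le_add hG (Finset.sum_le_sum hh)).trans ?_
  rw [Finset.sum_add_distrib]
  have e1 : ∑ k ∈ Finset.range (K + 1), γ * (γ ^ k * B) / (1 - γ)
      = γ * B / (1 - γ) * ∑ k ∈ Finset.range (K + 1), γ ^ k := by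
    rw [Finset.mul_sum]
    exact Finset.sum_congr rfl fun k _ => by ring
  have e2 : γ * B / (1 - γ) * ∑ k ∈ Finset.range (K + 1), γ ^ k ≤ γ * B / (1 - γ) ^ 2 := by
    refine (mul_le_mul_of_nonneg_left hgeom (by positivity)).trans (le_of_eq ?_)
    field_simp
  rw [e1]
  simp only [Finset.sum_const, Finset.card_range, nsmul_eq_mul]
  push_cast at hG ⊢
  linarith

end Propagation

/-- Discounted tail sums of a nonnegative sequence with finite second discounted moment. -/
lemma exists_tail_sums {γ : ℝ} (hγ : 0 ≤ γ) {c : ℕ → ℝ} (hc : ∀ m, 1 ≤ m → 0 ≤ c m)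
    (hs : Summable fun k : ℕ => ((k + 1 : ℕ) : ℝ) ^ 2 * γ ^ (k + 1) * c (k + 1)) (hγ0 : γ ≠ 0) :
    ∃ T T' : ℕ → ℝ, (∀ m, 1 ≤ m → 0 ≤ T m) ∧ (∀ m, 1 ≤ m → T m = c m + γ * T (m + 1)) ∧
      (∀ m, 1 ≤ m → 0 ≤ T' m) ∧ (∀ m, 1 ≤ m → T' m = T m + γ * T' (m + 1)) ∧
      γ * T 1 ≤ ∑' k : ℕ, ((k + 1 : ℕ) : ℝ) ^ 2 * γ ^ (k + 1) * c (k + 1) ∧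
      γ * T' 1 ≤ ∑' k : ℕ, ((k + 1 : ℕ) : ℝ) ^ 2 * γ ^ (k + 1) * c (k + 1) ∧
      γ ^ 2 * T' 2 ≤ ∑' k : ℕ, ((k + 1 : ℕ) : ℝ) ^ 2 * γ ^ (k + 1) * c (k + 1) := by
  have hγp : 0 < γ := lt_of_le_of_ne hγ hγ0.symm
  have hs1 : ∀ m, 1 ≤ m → Summable fun i : ℕ => ((i : ℝ) + 1) * (γ ^ i * c (m + i)) := by
    intro m hm
    obtain ⟨m, rfl⟩ : ∃ n, m = n + 1 := ⟨m - 1, by omega⟩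
    have h1 := ((summable_nat_add_iff m).2 hs).mul_left ((γ ^ (m + 1))⁻¹)
    refine Summable.of_nonneg_of_le (fun i => ?_) (fun i => ?_) h1
    · exact mul_nonneg (by positivity) (mul_nonneg (by positivity) (hc _ (by omega)))
    · have hci := hc (m + 1 + i) (by omega)
      rw [show i + m + 1 = m + 1 + i by ring]
      have e : (γ ^ (m + 1))⁻¹ * (((m + 1 + i : ℕ) : ℝ) ^ 2 * γ ^ (m + 1 + i) * c (m + 1 + i))
          = ((m + 1 + i : ℕ) : ℝ) ^ 2 * (γ ^ i * c (m + 1 + i)) := by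
        rw [pow_add γ (m + 1) i]; field_simp
      rw [e]
      refine mul_le_mul_of_nonneg_right ?_ (by positivity)
      push_cast
      have : (0 : ℝ) ≤ m := Nat.cast_nonneg m
      have : (0 : ℝ) ≤ i := Nat.cast_nonneg i
      nlinarith
  have hs0 : ∀ m, 1 ≤ m → Summable fun i : ℕ => γ ^ i * c (m + i) := by
    intro m hm
    refine Summable.of_nonneg_of_le (fun i => ?_) (fun i => ?_) (hs1 m hm)
    · exact mul_nonneg (by positivity) (hc _ (by omega))
    · have : 0 ≤ γ ^ i * c (m + i) := mul_nonneg (by positivity) (hc _ (by omega))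
      have : (0 : ℝ) ≤ i := Nat.cast_nonneg i
      nlinarith
  set T : ℕ → ℝ := fun m => ∑' i : ℕ, γ ^ i * c (m + i) with hT
  set T' : ℕ → ℝ := fun m => ∑' i : ℕ, ((i : ℝ) + 1) * (γ ^ i * c (m + i)) with hT'
  have hT0 : ∀ m, 1 ≤ m → 0 ≤ T m := fun m hm =>
    tsum_nonneg fun i => mul_nonneg (by positivity) (hc _ (by omega))
  have hT'0 : ∀ m, 1 ≤ m → 0 ≤ T' m := fun m hm =>
    tsum_nonneg fun i => mul_nonneg (by positivity) (mul_nonneg (by positivity) (hc _ (by omega)))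
  have hTr : ∀ m, 1 ≤ m → T m = c m + γ * T (m + 1) := by
    intro m hm
    rw [hT]
    simp only
    rw [(hs0 m hm).tsum_eq_zero_add, ← tsum_mul_left]
    simp only [pow_zero, one_mul, add_zero]
    congr 1
    refine tsum_congr fun i => ?_
    rw [show m + (i + 1) = m + 1 + i by ring]
    ring
  have hT'r : ∀ m, 1 ≤ m → T' m = T m + γ * T' (m + 1) := by
    intro m hm
    have h1 : T' m = T m + ∑' i : ℕ, (i : ℝ) * (γ ^ i * c (m + i)) := by
      rw [hT, hT']
      simp only
      rw [← (hs0 m hm).tsum_add]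
      · exact tsum_congr fun i => by ring
      · have := (hs1 m hm).sub (hs0 m hm)
        refine this.congr fun i => by ring
    have h2 : Summable fun i : ℕ => (i : ℝ) * (γ ^ i * c (m + i)) := by
      refine ((hs1 m hm).sub (hs0 m hm)).congr fun i => by ring
    rw [h1, h2.tsum_eq_zero_add, hT']
    simp only [Nat.cast_zero, zero_mul, zero_add]
    rw [← tsum_mul_left]
    congr 1
    refine tsum_congr fun i => ?_
    rw [show m + (i + 1) = m + 1 + i by ring]
    push_cast
    ring
  have hT'1 : γ * T' 1 ≤ ∑' k : ℕ, ((k + 1 : ℕ) : ℝ) ^ 2 * γ ^ (k + 1) * c (k + 1) := by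
    rw [hT']
    simp only
    rw [← tsum_mul_left]
    refine ((hs1 1 le_rfl).mul_left γ).tsum_le_tsum (fun i => ?_) hs
    have hci := hc (i + 1) (by omega)
    rw [show 1 + i = i + 1 by ring]
    have e : γ * (((i : ℝ) + 1) * (γ ^ i * c (i + 1)))
        = ((i : ℝ) + 1) * (γ ^ (i + 1) * c (i + 1)) := by ring
    rw [e, mul_assoc]
    refine mul_le_mul_of_nonneg_right ?_ (by positivity)
    push_cast
    have : (0 : ℝ) ≤ i := Nat.cast_nonneg i
    nlinarith
  have hr1 := hT'r 1 le_rfl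
  have h2 := hT'0 2 (by omega)
  refine ⟨T, T', hT0, hTr, hT'0, hT'r, le_trans ?_ hT'1, hT'1, le_trans ?_ hT'1⟩
  · rw [hr1]
    have : 0 ≤ γ * T' (1 + 1) := mul_nonneg hγ h2
    nlinarith
  · rw [hr1]
    have := hT0 1 le_rfl
    have h3 : 0 ≤ γ * T 1 := by positivity
    simp only [Nat.reduceAdd]
    nlinarith

section SoftMax

variable {A : Type*} [Fintype A] [Nonempty A]

lemma sum_exp_pos (u : A → ℝ) : 0 < ∑ a, Real.exp (u a) :=
  Finset.sum_pos (fun _ _ => Real.exp_pos _) Finset.univ_nonempty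

/-- The gradient inequality for the convex function log-sum-exp. -/
lemma sum_softmax_mul_sub_le (u v : A → ℝ) :
    ∑ a, Real.exp (u a) / (∑ b, Real.exp (u b)) * (v a - u a)
      ≤ Real.log (∑ a, Real.exp (v a)) - Real.log (∑ a, Real.exp (u a)) := by
  have hu := sum_exp_pos u
  have hv := sum_exp_pos v
  rw [← Real.log_div hv.ne' hu.ne', Real.le_log_iff_exp_le (div_pos hv hu)]
  have h := convexOn_exp.map_sum_le (t := Finset.univ)
    (w := fun a => Real.exp (u a) / ∑ b, Real.exp (u b)) (p := fun a => v a - u a)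
    (fun a _ => by positivity) (by rw [← Finset.sum_div]; exact div_self hu.ne')
    (fun _ _ => Set.mem_univ _)
  simp only [smul_eq_mul] at h
  refine h.trans (le_of_eq ?_)
  rw [Finset.sum_div]
  refine Finset.sum_congr rfl fun a _ => ?_
  rw [Real.exp_sub]
  field_simp

lemma le_log_sum_exp (u : A → ℝ) (a : A) : u a ≤ Real.log (∑ b, Real.exp (u b)) := by
  rw [Real.le_log_iff_exp_le (sum_exp_pos u)]
  exact Finset.single_le_sum (f := fun b => Real.exp (u b)) (fun _ _ => (Real.exp_pos _).le)
    (Finset.mem_univ a)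

end SoftMax

section MirrorDescent

variable {S A : Type*} [MeasurableSpace S] [MeasurableSpace A] {d : ℕ}

lemma Feature.abs_lin_le (φ : Feature S A d) (θ : Param d) (z : S × A) : |φ.lin θ z| ≤ ‖θ‖ :=
  (abs_real_inner_le_norm _ _).trans
    (mul_le_of_le_one_right (norm_nonneg _) (φ.norm_le_one z))

lemma Feature.bddMeas_lin (φ : Feature S A d) (θ : Param d) : BddMeas (φ.lin θ) :=
  ⟨φ.measurable_lin θ, ‖θ‖, φ.abs_lin_le θ⟩

lemma MDP.op_eq_integral (M : MDP S A) (π : Policy S A) {g : S × A → ℝ} (hg : BddMeas g)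
    (z : S × A) : M.op π g z = ∫ s, ∫ a, g (s, a) ∂(π.1 s) ∂(M.P z) := by
  unfold MDP.op MDP.step
  rw [ProbabilityTheory.integral_compProd]
  · rfl
  · exact hg.integrable _

lemma bddMeas_integral_policy (π : Policy S A) {g : S × A → ℝ} (hg : BddMeas g) :
    BddMeas fun s => ∫ a, g (s, a) ∂(π.1 s) := by
  obtain ⟨C, hC⟩ := hg.bounded
  refine ⟨?_, C, fun s => abs_integral_le_of_abs_le fun a => hC (s, a)⟩
  exact (StronglyMeasurable.integral_kernel_prod_right' (κ := π.1)
    hg.measurable.stronglyMeasurable).measurable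

lemma Feature.gibbs_nonneg [Fintype A] (φ : Feature S A d) (η : ℝ) (θ : Param d) (s : S) (a : A) :
    0 ≤ φ.gibbs η θ s a := by
  unfold Feature.gibbs; positivity

variable {φ : Feature S A d} {β : ℝ} {K : ℕ} {θ ω : ℕ → Param d}

lemma Feature.lin_add_smul (φ : Feature S A d) (a b : ℝ) (x y : Param d) (z : S × A) :
    φ.lin (a • x + b • y) z = a * φ.lin x z + b * φ.lin y z := by
  simp [Feature.lin, inner_add_left, real_inner_smul_left]

/-- The logits of the energy-based policies accumulate the critics. -/
lemma Feature.logit_succ (φ : Feature S A d)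
    (hθ : ∀ k ≤ K, (((k + 1 : ℕ) : ℝ) / β) • θ (k + 1) = β⁻¹ • ω k + ((k : ℝ) / β) • θ k)
    {k : ℕ} (hk : k ≤ K) (z : S × A) :
    ((k + 1 : ℕ) : ℝ) / β * φ.lin (θ (k + 1)) z
      = β⁻¹ * φ.lin (ω k) z + (k : ℝ) / β * φ.lin (θ k) z := by
  have := congrArg (fun x => φ.lin x z) (hθ k hk)
  rw [φ.lin_add_smul] at this
  rw [← this, Feature.lin, Feature.lin, real_inner_smul_left]

/-- The actor parameters are averages of the critic parameters. -/
lemma norm_actor_le {R : ℝ} (hβ : 0 < β)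
    (hθ : ∀ k ≤ K, (((k + 1 : ℕ) : ℝ) / β) • θ (k + 1) = β⁻¹ • ω k + ((k : ℝ) / β) • θ k)
    (hω : ∀ k ≤ K, ‖ω k‖ ≤ R) {k : ℕ} (hk : k ≤ K) : ‖θ (k + 1)‖ ≤ R := by
  have key : ∀ n ≤ K + 1, ‖((n : ℝ) / β) • θ n‖ ≤ n / β * R := by
    intro n
    induction n with
    | zero => simp
    | succ n ih =>
      intro hn
      rw [hθ n (by omega)]
      refine (norm_add_le _ _).trans ?_
      refine (add_le_add (b := β⁻¹ * R) ?_ (ih (by omega))).trans (le_of_eq ?_)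
      · rw [norm_smul, Real.norm_of_nonneg (by positivity)]
        exact mul_le_mul_of_nonneg_left (hω n (by omega)) (by positivity)
      · push_cast; field_simp; ring
  have h := key (k + 1) (by omega)
  rw [norm_smul, Real.norm_of_nonneg (by positivity)] at h
  exact le_of_mul_le_mul_left h (by positivity)

variable [Fintype A] [Nonempty A] [MeasurableSingletonClass A]

lemma Feature.integral_policy (φ : Feature S A d) (η : ℝ) (θ : Param d) (s : S) (g : A → ℝ) :
    ∫ a, g a ∂((φ.policy η θ).1 s) = ∑ a, φ.gibbs η θ s a * g a := by
  change ∫ a, g a ∂(∑ a : A, ENNReal.ofReal (φ.gibbs η θ s a) • Measure.dirac a) = _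
  rw [integral_finsetSum_measure]
  · refine Finset.sum_congr rfl fun a _ => ?_
    rw [integral_smul_measure, integral_dirac, ENNReal.toReal_ofReal (φ.gibbs_nonneg η θ s a)]
    rfl
  · intro a _
    exact (integrable_dirac (by simp)).smul_measure ENNReal.ofReal_ne_top

lemma Feature.policy_improvement (M : MDP S A) (hβ : 0 < β)
    (hθ : ∀ k ≤ K, (((k + 1 : ℕ) : ℝ) / β) • θ (k + 1) = β⁻¹ • ω k + ((k : ℝ) / β) • θ k)
    {k : ℕ} (hk : k ≤ K) (z : S × A) :
    M.op (φ.policy ((k : ℝ) / β) (θ k)) (φ.lin (ω k)) z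
      ≤ M.op (φ.policy (((k + 1 : ℕ) : ℝ) / β) (θ (k + 1))) (φ.lin (ω k)) z := by
  have hb := φ.bddMeas_lin (ω k)
  rw [M.op_eq_integral _ hb, M.op_eq_integral _ hb]
  refine integral_mono ((bddMeas_integral_policy _ hb).integrable _)
    ((bddMeas_integral_policy _ hb).integrable _) fun s => ?_
  simp only [φ.integral_policy]
  set u : A → ℝ := fun a => (k : ℝ) / β * φ.lin (θ k) (s, a)
  set v : A → ℝ := fun a => ((k + 1 : ℕ) : ℝ) / β * φ.lin (θ (k + 1)) (s, a)
  have hvu : ∀ a, φ.lin (ω k) (s, a) = β * (v a - u a) := fun a => by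
    simp only [u, v, φ.logit_succ hθ hk]
    field_simp
    ring
  have h1 := sum_softmax_mul_sub_le u v
  have h2 := sum_softmax_mul_sub_le v u
  have h3 : ∀ a, φ.gibbs ((k : ℝ) / β) (θ k) s a = Real.exp (u a) / ∑ b, Real.exp (u b) :=
    fun a => rfl
  have h4 : ∀ a, φ.gibbs (((k + 1 : ℕ) : ℝ) / β) (θ (k + 1)) s a
      = Real.exp (v a) / ∑ b, Real.exp (v b) := fun a => rfl
  simp only [h3, h4, hvu]
  have e1 : ∑ a, Real.exp (u a) / (∑ b, Real.exp (u b)) * (β * (v a - u a))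
      = β * ∑ a, Real.exp (u a) / (∑ b, Real.exp (u b)) * (v a - u a) := by
    rw [Finset.mul_sum]; exact Finset.sum_congr rfl fun a _ => by ring
  have e2 : ∑ a, Real.exp (v a) / (∑ b, Real.exp (v b)) * (β * (v a - u a))
      = -(β * ∑ a, Real.exp (v a) / (∑ b, Real.exp (v b)) * (u a - v a)) := by
    rw [Finset.mul_sum, ← Finset.sum_neg_distrib]
    exact Finset.sum_congr rfl fun a _ => by ring
  rw [e1, e2]
  nlinarith

lemma Feature.regret_le (M : MDP S A) (πs : Policy S A) (hβ : 0 < β)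
    (hθ : ∀ k ≤ K, (((k + 1 : ℕ) : ℝ) / β) • θ (k + 1) = β⁻¹ • ω k + ((k : ℝ) / β) • θ k)
    {n : ℕ} (hn : n ≤ K) (z : S × A) :
    ∑ k ∈ Finset.range (n + 1), (M.op πs (φ.lin (ω k)) z -
      M.op (φ.policy (((k + 1 : ℕ) : ℝ) / β) (θ (k + 1))) (φ.lin (ω k)) z)
      ≤ β * Real.log (Fintype.card A) := by
  have hb := fun k => φ.bddMeas_lin (ω k)
  have hp := fun (π : Policy S A) k => bddMeas_integral_policy π (hb k)
  simp only [M.op_eq_integral _ (hb _)]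
  rw [Finset.sum_congr rfl fun k _ =>
      (integral_sub ((hp πs k).integrable (M.P z)) ((hp _ k).integrable (M.P z))).symm,
    ← integral_finsetSum _ fun k _ => ((hp πs k).sub (hp _ k)).integrable _]
  refine integral_le_of_le (BddMeas.sum _ fun k _ => (hp πs k).sub (hp _ k)) fun s => ?_
  set L : ℕ → A → ℝ := fun k a => (k : ℝ) / β * φ.lin (θ k) (s, a) with hL
  set Z : ℕ → ℝ := fun k => Real.log (∑ a, Real.exp (L k a)) with hZ
  have hq : ∀ k ≤ K, ∀ a, φ.lin (ω k) (s, a) = β * (L (k + 1) a - L k a) := fun k hk a => by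
    simp only [hL, φ.logit_succ hθ hk]
    field_simp
    ring
  have hL0 : ∀ a, L 0 a = 0 := fun a => by simp [hL]
  have hZ0 : Z 0 = Real.log (Fintype.card A) := by simp [hZ, hL0]
  have hLb : BddMeas (fun a => L (n + 1) a) := by
    exact (((φ.bddMeas_lin (θ (n + 1))).const_mul (((n + 1 : ℕ) : ℝ) / β)).comp
      measurable_prodMk_left)
  rw [Finset.sum_sub_distrib]
  have h1 : ∑ k ∈ Finset.range (n + 1), ∫ a, φ.lin (ω k) (s, a) ∂(πs.1 s) ≤ β * Z (n + 1) := by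
    rw [← integral_finsetSum _ fun k _ => ((hb k).comp measurable_prodMk_left).integrable _]
    have e : ∀ a, ∑ k ∈ Finset.range (n + 1), φ.lin (ω k) (s, a) = β * L (n + 1) a := by
      intro a
      rw [Finset.sum_congr rfl fun k hk =>
        hq k (by have := Finset.mem_range.1 hk; omega) a, ← Finset.mul_sum,
        Finset.sum_range_sub (fun k => L k a), hL0, sub_zero]
    simp only [e]
    exact integral_le_of_le (hLb.const_mul β) fun a =>
      mul_le_mul_of_nonneg_left (le_log_sum_exp _ a) hβ.le
  have h2 : β * (Z (n + 1) - Z 0) ≤ ∑ k ∈ Finset.range (n + 1),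
      ∫ a, φ.lin (ω k) (s, a) ∂((φ.policy (((k + 1 : ℕ) : ℝ) / β) (θ (k + 1))).1 s) := by
    rw [← Finset.sum_range_sub Z, Finset.mul_sum]
    refine Finset.sum_le_sum fun k hk => ?_
    have hk' : k ≤ K := by have := Finset.mem_range.1 hk; omega
    rw [φ.integral_policy]
    have h := sum_softmax_mul_sub_le (L (k + 1)) (L k)
    have e : ∑ a, φ.gibbs (((k + 1 : ℕ) : ℝ) / β) (θ (k + 1)) s a * φ.lin (ω k) (s, a)
        = -(β * ∑ a, Real.exp (L (k + 1) a) / (∑ b, Real.exp (L (k + 1) b)) *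
          (L k a - L (k + 1) a)) := by
      rw [Finset.mul_sum, ← Finset.sum_neg_distrib]
      refine Finset.sum_congr rfl fun a _ => ?_
      rw [hq k hk']
      simp only [Feature.gibbs, hL]
      ring
    rw [e]
    simp only [hZ]
    nlinarith
  rw [hZ0] at h2
  linarith

end MirrorDescent

section ChangeOfMeasure

variable {α : Type*} [MeasurableSpace α]

lemma lintegral_le_eLpNorm_top_mul {μ ν : Measure α} [SigmaFinite μ] [SigmaFinite ν]
    (h : μ ≪ ν) {g : α → ℝ≥0∞} (hg : Measurable g) :
    ∫⁻ z, g z ∂μ ≤ eLpNorm (μ.rnDeriv ν) ∞ ν * ∫⁻ z, g z ∂ν := by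
  rw [← lintegral_rnDeriv_mul h hg.aemeasurable, ← lintegral_const_mul _ hg]
  refine lintegral_mono_ae ?_
  filter_upwards [enorm_ae_le_eLpNormEssSup (μ.rnDeriv ν) ν] with z hz
  rw [eLpNorm_exponent_top]
  exact mul_le_mul_left (by simpa using hz) _

lemma lintegral_le_eLpNorm_two_mul {μ ν : Measure α} [SigmaFinite μ] [SigmaFinite ν]
    (h : μ ≪ ν) {g : α → ℝ≥0∞} (hg : Measurable g) :
    ∫⁻ z, g z ∂μ ≤ eLpNorm (μ.rnDeriv ν) 2 ν * eLpNorm g 2 ν := by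
  rw [← lintegral_rnDeriv_mul h hg.aemeasurable]
  have := ENNReal.lintegral_mul_le_Lp_mul_Lq ν (p := 2) (q := 2)
    (Real.HolderConjugate.two_two) (Measure.measurable_rnDeriv μ ν).aemeasurable hg.aemeasurable
  rw [eLpNorm_eq_lintegral_rpow_enorm_toReal (by norm_num) (by norm_num),
    eLpNorm_eq_lintegral_rpow_enorm_toReal (by norm_num) (by norm_num)]
  simpa using this

end ChangeOfMeasure

section Concentrability

variable {S A : Type*} [MeasurableSpace S] [MeasurableSpace A] {M : MDP S A} {γ : ℝ}
  {ρ ρs ρk : Measure (S × A)}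

lemma MDP.Concentrable.conc_ne_top (h : M.Concentrable γ ρ ρs) (hγ : 0 < γ) (hγ1 : γ < 1) (k : ℕ) :
    M.conc ρ ρs (k + 1) ≠ ∞ := by
  intro htop
  have h2 := h.2
  unfold MDP.concCoeff at h2
  have h3 := (ENNReal.mul_lt_top_iff.1 h2).resolve_right (by
    have h1γ : 0 < 1 - γ := sub_pos.2 hγ1
    rintro (h | h)
    · rw [ENNReal.ofReal_eq_zero] at h
      exact absurd h (not_le.2 (by positivity))
    · rw [ENNReal.tsum_eq_zero] at h
      have := h k
      rw [htop, mul_eq_zero] at this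
      rcases this with h | h
      · rw [ENNReal.ofReal_eq_zero] at h
        exact absurd h (not_le.2 (by positivity))
      · exact ENNReal.top_ne_zero h)
  have h4 := ENNReal.ne_top_of_tsum_ne_top h3.2.ne k
  rw [htop] at h4
  refine h4 (ENNReal.mul_top ?_)
  rw [Ne, ENNReal.ofReal_eq_zero, not_le]
  positivity

/-- The concentrability coefficient as a convergent real series. -/
lemma MDP.Concentrable.hasSum_toReal (h : M.Concentrable γ ρ ρs) (hγ : 0 < γ) (hγ1 : γ < 1) :
    HasSum (fun k : ℕ => ((k + 1 : ℕ) : ℝ) ^ 2 * γ ^ (k + 1) * (M.conc ρ ρs (k + 1)).toReal)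
      ((M.concCoeff γ ρ ρs).toReal / (1 - γ) ^ 2) := by
  have h1γ : 0 < 1 - γ := sub_pos.2 hγ1
  have h2 := h.2
  have hne : ENNReal.ofReal ((1 - γ) ^ 2) ≠ 0 := by
    rw [Ne, ENNReal.ofReal_eq_zero, not_le]; positivity
  have h3 : ∑' k : ℕ, ENNReal.ofReal (((k + 1 : ℕ) : ℝ) ^ 2 * γ ^ (k + 1)) * M.conc ρ ρs (k + 1)
      ≠ ∞ := fun htop => by
    unfold MDP.concCoeff at h2
    rw [htop, ENNReal.mul_top hne] at h2
    exact lt_irrefl _ h2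
  have h4 := (ENNReal.hasSum_toReal h3)
  have e : (M.concCoeff γ ρ ρs).toReal / (1 - γ) ^ 2 = ∑' k : ℕ,
      (ENNReal.ofReal (((k + 1 : ℕ) : ℝ) ^ 2 * γ ^ (k + 1)) * M.conc ρ ρs (k + 1)).toReal := by
    unfold MDP.concCoeff
    rw [ENNReal.toReal_mul, ENNReal.toReal_ofReal (by positivity), ENNReal.tsum_toReal_eq]
    · field_simp
    · exact ENNReal.ne_top_of_tsum_ne_top h3
  rw [e]
  convert h4 using 2 with k
  rw [ENNReal.toReal_mul, ENNReal.toReal_ofReal (by positivity)]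

variable [IsProbabilityMeasure ρ] [IsProbabilityMeasure ρs]

lemma MDP.Concentrable.lintegral_le (h : M.Concentrable γ ρ ρs) {m : ℕ} (hm : 1 ≤ m)
    {μ : Measure (S × A)} (hμ : μ ∈ M.reach ρ m) {g : S × A → ℝ≥0∞} (hg : Measurable g) :
    ∫⁻ z, g z ∂μ ≤ M.conc ρ ρs m * ∫⁻ z, g z ∂ρs := by
  have := M.isProbabilityMeasure_of_mem_reach hμ
  obtain ⟨ϖ, rfl⟩ := hμ
  refine (lintegral_le_eLpNorm_top_mul (h.1 m hm ϖ) hg).trans ?_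
  exact mul_le_mul_left (le_iSup (fun ϖ => eLpNorm ((M.future ρ ϖ m).rnDeriv ρs) ∞ ρs) ϖ) _

lemma MDP.Concentrable.one_le_conc [Nonempty (Policy S A)] (h : M.Concentrable γ ρ ρs) {m : ℕ}
    (hm : 1 ≤ m) : 1 ≤ M.conc ρ ρs m := by
  have hμ : M.future ρ (fun _ => Classical.arbitrary _) m ∈ M.reach ρ m := ⟨_, rfl⟩
  have := M.isProbabilityMeasure_of_mem_reach hμ
  simpa using h.lintegral_le hm hμ (g := fun _ => 1) measurable_const

lemma MDP.Concentrable.le_concCoeff [Nonempty (Policy S A)] (h : M.Concentrable γ ρ ρs)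
    (hγ : 0 < γ) (hγ1 : γ < 1) : (1 - γ) ^ 2 * γ ≤ (M.concCoeff γ ρ ρs).toReal := by
  have h1γ : 0 < 1 - γ := sub_pos.2 hγ1
  have hs := h.hasSum_toReal hγ hγ1
  have h1 := le_hasSum hs 0 fun k _ => by positivity
  have h2 : 1 ≤ (M.conc ρ ρs 1).toReal := by
    rw [← ENNReal.toReal_one]
    exact (ENNReal.toReal_le_toReal (by simp) (h.conc_ne_top hγ hγ1 0)).2 (h.one_le_conc le_rfl)
  rw [le_div_iff₀ (by positivity)] at h1
  simp only [zero_add, Nat.cast_one, one_pow, one_mul, pow_one] at h1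
  have h3 : γ * 1 ≤ γ * (M.conc ρ ρs 1).toReal := mul_le_mul_of_nonneg_left h2 hγ.le
  have h4 : 0 ≤ (1 - γ) ^ 2 := by positivity
  nlinarith

variable [IsProbabilityMeasure ρk] {φstar : ℝ}

lemma ConcentrableAt.one_le (h : ConcentrableAt ρs ρk φstar) : 1 ≤ φstar := by
  have h1 := lintegral_le_eLpNorm_two_mul h.1 (g := fun _ => 1) measurable_const
  have h2 : eLpNorm (fun _ : S × A => (1 : ℝ≥0∞)) 2 ρk = 1 := by
    rw [eLpNorm_const _ (by norm_num) (IsProbabilityMeasure.ne_zero _)]; simp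
  rw [h2, mul_one] at h1
  simp only [lintegral_const, measure_univ, mul_one] at h1
  exact ENNReal.one_le_ofReal.1 (h1.trans h.2)

lemma MDP.Concentrable.integral_abs_le (h : M.Concentrable γ ρ ρs) (hγ : 0 < γ) (hγ1 : γ < 1)
    (hk : ConcentrableAt ρs ρk φstar) {f : S × A → ℝ} (hf : BddMeas f) {e : ℝ} (he : 0 ≤ e)
    (hfe : ∫ z, f z ^ 2 ∂ρk ≤ e ^ 2)
    {m : ℕ} (hm : 1 ≤ m) {μ : Measure (S × A)} (hμ : μ ∈ M.reach ρ m) :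
    ∫ z, |f z| ∂μ ≤ (M.conc ρ ρs m).toReal * (φstar * e) := by
  have := M.isProbabilityMeasure_of_mem_reach hμ
  have hφ : 0 ≤ φstar := zero_le_one.trans hk.one_le
  have hgm : Measurable fun z => ENNReal.ofReal |f z| := hf.measurable.abs.ennreal_ofReal
  have h1 := h.lintegral_le hm hμ hgm
  have h2 := lintegral_le_eLpNorm_two_mul hk.1 hgm
  have h3 : eLpNorm (fun z => ENNReal.ofReal |f z|) 2 ρk ≤ ENNReal.ofReal e := by
    rw [eLpNorm_eq_lintegral_rpow_enorm_toReal (by norm_num) (by norm_num)]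
    have e1 : ∫⁻ z, ‖ENNReal.ofReal |f z|‖ₑ ^ (2 : ℝ≥0∞).toReal ∂ρk
        = ENNReal.ofReal (∫ z, f z ^ 2 ∂ρk) := by
      have hf2 : BddMeas fun z => f z ^ 2 := by simpa [sq] using hf.mul hf
      rw [ofReal_integral_eq_lintegral_ofReal (hf2.integrable _) (ae_of_all _ fun z => sq_nonneg _)]
      refine lintegral_congr fun z => ?_
      simp only [enorm_eq_self, ENNReal.toReal_ofNat]
      rw [ENNReal.ofReal_rpow_of_nonneg (abs_nonneg _) (by norm_num)]
      congr 1
      norm_cast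
      exact sq_abs _
    rw [e1, ENNReal.ofReal_rpow_of_nonneg (integral_nonneg fun z => sq_nonneg _) (by norm_num)]
    refine ENNReal.ofReal_le_ofReal ?_
    rw [ENNReal.toReal_ofNat, ← Real.sqrt_eq_rpow]
    exact Real.sqrt_le_iff.2 ⟨he, hfe⟩
  have hc : M.conc ρ ρs m ≠ ∞ := by
    obtain ⟨n, rfl⟩ : ∃ n, m = n + 1 := ⟨m - 1, by omega⟩
    exact h.conc_ne_top hγ hγ1 n
  rw [integral_eq_lintegral_of_nonneg_ae (ae_of_all _ fun z => abs_nonneg _)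
    hf.measurable.abs.aestronglyMeasurable]
  refine ENNReal.toReal_le_of_le_ofReal (by positivity) ?_
  refine h1.trans ?_
  rw [ENNReal.ofReal_mul ENNReal.toReal_nonneg, ENNReal.ofReal_toReal hc, ENNReal.ofReal_mul hφ]
  exact mul_le_mul_right (h2.trans (mul_le_mul' hk.2 h3)) _

end Concentrability

section Hoeffding

lemma cosh_sqrt_convex {s t w : ℝ} (hs : 0 ≤ s) (ht : 0 ≤ t) (hw : 0 ≤ w) (hw1 : w ≤ 1) :
    Real.cosh (Real.sqrt (w * s + (1 - w) * t))
      ≤ w * Real.cosh (Real.sqrt s) + (1 - w) * Real.cosh (Real.sqrt t) := by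
  have hw' : 0 ≤ 1 - w := sub_nonneg.2 hw1
  refine hasSum_le (fun n => ?_) (Real.hasSum_cosh _)
    (((Real.hasSum_cosh (Real.sqrt s)).mul_left w).add
      ((Real.hasSum_cosh (Real.sqrt t)).mul_left (1 - w)))
  rw [pow_mul, pow_mul, pow_mul, Real.sq_sqrt (by positivity), Real.sq_sqrt hs, Real.sq_sqrt ht,
    mul_div_assoc', mul_div_assoc', ← add_div]
  refine div_le_div_of_nonneg_right ?_ (by positivity)
  have := (convexOn_pow n).2 (Set.mem_Ici.2 hs) (Set.mem_Ici.2 ht) hw hw' (by ring)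
  simpa using this

lemma norm_sum_sample_le {E Y : Type*} [SeminormedAddCommGroup E] {X : Y → E} {b : ℝ}
    (hXb : ∀ y, ‖X y‖ ≤ b) {N : ℕ} (y : Fin N → Y) :
    ‖∑ l, X (y l)‖ ≤ N * b := by
  refine (norm_sum_le_of_le _ fun l _ => hXb (y l)).trans (le_of_eq ?_)
  simp

variable {E : Type*} [NormedAddCommGroup E] [InnerProductSpace ℝ E]

lemma cosh_norm_add_le {x v : E} {b : ℝ} (hv : ‖v‖ ≤ b) :
    Real.cosh ‖x + v‖ ≤ Real.cosh ‖x‖ * Real.cosh b +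
      ⟪x, v⟫ * (Real.sinh ‖x‖ * Real.sinh b / (‖x‖ * b)) := by
  have hb : 0 ≤ b := (norm_nonneg v).trans hv
  rcases eq_or_lt_of_le (norm_nonneg x) with hx | hx
  · have hx0 : x = 0 := norm_eq_zero.1 hx.symm
    subst hx0
    simp only [zero_add, norm_zero, Real.cosh_zero, one_mul, inner_zero_left, zero_mul, add_zero]
    exact Real.cosh_le_cosh.2 (by rwa [abs_of_nonneg (norm_nonneg v), abs_of_nonneg hb])
  rcases eq_or_lt_of_le hb with hb0 | hb0
  · have hv0 : v = 0 := norm_le_zero_iff.1 (by rwa [← hb0] at hv)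
    subst hv0
    simp [← hb0]
  have hab : 0 < ‖x‖ * b := mul_pos hx hb0
  have ht : |⟪x, v⟫| ≤ ‖x‖ * b :=
    (abs_real_inner_le_norm x v).trans (mul_le_mul_of_nonneg_left hv hx.le)
  obtain ⟨ht1, ht2⟩ := abs_le.1 ht
  set t : ℝ := ⟪x, v⟫ with htdef
  set w : ℝ := (1 + t / (‖x‖ * b)) / 2 with hw
  have hd1 : -1 ≤ t / (‖x‖ * b) := by rw [le_div_iff₀ hab]; linarith
  have hd2 : t / (‖x‖ * b) ≤ 1 := by rw [div_le_iff₀ hab]; linarith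
  have hw0 : 0 ≤ w := by rw [hw]; linarith
  have hw1 : w ≤ 1 := by rw [hw]; linarith
  have hconv := cosh_sqrt_convex (sq_nonneg (‖x‖ + b)) (sq_nonneg (‖x‖ - b)) hw0 hw1
  rw [Real.sqrt_sq_eq_abs, Real.sqrt_sq_eq_abs, Real.cosh_abs, Real.cosh_abs, Real.cosh_add,
    Real.cosh_sub] at hconv
  have e1 : w * (‖x‖ + b) ^ 2 + (1 - w) * (‖x‖ - b) ^ 2 = ‖x‖ ^ 2 + b ^ 2 + 2 * t := by
    rw [hw]; field_simp; ring
  rw [e1] at hconv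
  have hle : ‖x + v‖ ≤ Real.sqrt (‖x‖ ^ 2 + b ^ 2 + 2 * t) := by
    refine Real.le_sqrt_of_sq_le ?_
    rw [norm_add_sq_real]
    have : ‖v‖ ^ 2 ≤ b ^ 2 := pow_le_pow_left₀ (norm_nonneg v) hv 2
    linarith
  have hcosh : Real.cosh ‖x + v‖ ≤ Real.cosh (Real.sqrt (‖x‖ ^ 2 + b ^ 2 + 2 * t)) :=
    Real.cosh_le_cosh.2 (by
      rwa [abs_of_nonneg (norm_nonneg _), abs_of_nonneg (Real.sqrt_nonneg _)])
  refine (hcosh.trans hconv).trans (le_of_eq ?_)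
  rw [hw]
  field_simp
  ring

variable [CompleteSpace E] [MeasurableSpace E] [BorelSpace E] [SecondCountableTopology E]
  {Y : Type*} [MeasurableSpace Y]

lemma integral_cosh_norm_sum_le {p : Measure Y} [IsProbabilityMeasure p] {X : Y → E}
    (hX : Measurable X) {b : ℝ} (hXb : ∀ y, ‖X y‖ ≤ b) (hX0 : ∫ y, X y ∂p = 0) (N : ℕ) :
    ∫ y, Real.cosh ‖∑ l, X (y l)‖ ∂(Measure.pi fun _ : Fin N => p) ≤ Real.cosh b ^ N := by
  have hmeas : ∀ N : ℕ, Measurable fun y : Fin N → Y => ∑ l, X (y l) := fun N =>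
    Finset.measurable_sum _ fun l _ => hX.comp (measurable_pi_apply l)
  have hcosh : ∀ v : E, ∀ C : ℝ, ‖v‖ ≤ C → |Real.cosh ‖v‖| ≤ Real.cosh C := fun v C h => by
    rw [abs_of_pos (Real.cosh_pos _)]
    exact Real.cosh_le_cosh.2 (by
      rwa [abs_of_nonneg (norm_nonneg _), abs_of_nonneg ((norm_nonneg v).trans h)])
  have hbm : ∀ N : ℕ, BddMeas fun y : Fin N → Y => Real.cosh ‖∑ l, X (y l)‖ := fun N =>
    ⟨Real.continuous_cosh.measurable.comp (hmeas N).norm, Real.cosh (N * b), fun y =>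
      hcosh _ _ (norm_sum_sample_le hXb y)⟩
  induction N with
  | zero => simp
  | succ N ih =>
    have hmp := measurePreserving_piFinSuccAbove (fun _ : Fin (N + 1) => p) 0
    have hbm' : BddMeas fun z : Y × (Fin N → Y) => Real.cosh ‖(∑ l, X (z.2 l)) + X z.1‖ := by
      refine ⟨Real.continuous_cosh.measurable.comp
        (((hmeas N).comp measurable_snd).add (hX.comp measurable_fst)).norm,
        Real.cosh (N * b + b), fun z => hcosh _ _ ?_⟩
      exact (norm_add_le _ _).trans (add_le_add (norm_sum_sample_le hXb _) (hXb _))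
    have e1 : ∫ y, Real.cosh ‖∑ l, X (y l)‖ ∂(Measure.pi fun _ : Fin (N + 1) => p)
        = ∫ z, Real.cosh ‖(∑ l, X (z.2 l)) + X z.1‖ ∂(p.prod (Measure.pi fun _ : Fin N => p)) := by
      rw [← hmp.integral_comp' (g := fun z : Y × (Fin N → Y) =>
        Real.cosh ‖(∑ l, X (z.2 l)) + X z.1‖)]
      refine integral_congr_ae (ae_of_all _ fun y => ?_)
      simp only [Fin.sum_univ_succ, MeasurableEquiv.piFinSuccAbove_apply, Fin.insertNthEquiv_zero,
        Fin.consEquiv_symm_apply]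
      rw [add_comm]
      rfl
    rw [e1, integral_prod_symm _ (hbm'.integrable _)]
    have hXi : Integrable X p :=
      Integrable.of_bound hX.aestronglyMeasurable b (ae_of_all _ hXb)
    have hinner : ∀ y : Fin N → Y, ∫ a, Real.cosh ‖(∑ l, X (y l)) + X a‖ ∂p
        ≤ Real.cosh b * Real.cosh ‖∑ l, X (y l)‖ := by
      intro y
      set S : E := ∑ l, X (y l)
      have hint := integral_mono (μ := p) ((hbm'.comp measurable_prodMk_right).integrable p)
        ((integrable_const (Real.cosh ‖S‖ * Real.cosh b)).add
          ((hXi.const_inner S).mul_const (Real.sinh ‖S‖ * Real.sinh b / (‖S‖ * b))))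
        fun a => cosh_norm_add_le (x := S) (hXb a)
      refine hint.trans (le_of_eq ?_)
      rw [integral_add' (integrable_const _) ((hXi.const_inner S).mul_const _),
        integral_mul_const _ fun a => ⟪S, X a⟫, integral_inner hXi, hX0]
      simp [mul_comm]
    have hL : Integrable (fun y : Fin N → Y => ∫ a, Real.cosh ‖(∑ l, X (y l)) + X a‖ ∂p)
        (Measure.pi fun _ : Fin N => p) := (hbm'.integrable _).integral_prod_right
    refine (integral_mono hL (((hbm N).const_mul _).integrable _) hinner).trans ?_
    rw [integral_const_mul, pow_succ']
    exact mul_le_mul_of_nonneg_left ih (Real.cosh_pos b).le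

/-- Dimension-free Hoeffding inequality for bounded centred vectors in a Hilbert space. -/
lemma measure_norm_sum_ge_le {p : Measure Y} [IsProbabilityMeasure p] {X : Y → E}
    (hX : Measurable X) {B : ℝ} (hB : 0 < B) (hXb : ∀ y, ‖X y‖ ≤ B) (hX0 : ∫ y, X y ∂p = 0)
    {N : ℕ} (hN : 1 ≤ N) {Λ : ℝ} (hΛ : 0 ≤ Λ) :
    (Measure.pi fun _ : Fin N => p) {y | 2 * B * Λ * Real.sqrt N ≤ ‖∑ l, X (y l)‖}
      ≤ ENNReal.ofReal (2 * Real.exp (-(2 * Λ ^ 2))) := by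
  have hN0 : (0 : ℝ) < N := by exact_mod_cast hN
  have hsN : 0 < Real.sqrt N := Real.sqrt_pos.2 hN0
  set P : Measure (Fin N → Y) := Measure.pi fun _ => p
  set lam : ℝ := 2 * Λ / (B * Real.sqrt N) with hlam
  have hlam0 : 0 ≤ lam := by positivity
  have hsm : ∀ (y : Fin N → Y), ‖∑ l, lam • X (y l)‖ = lam * ‖∑ l, X (y l)‖ := fun y => by
    rw [← Finset.smul_sum, norm_smul, Real.norm_of_nonneg hlam0]
  have hXl : ∀ y, ‖lam • X y‖ ≤ lam * B := fun y => by
    rw [norm_smul, Real.norm_of_nonneg hlam0]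
    exact mul_le_mul_of_nonneg_left (hXb y) hlam0
  have hXs : Measurable fun y => lam • X y := hX.const_smul lam
  have hmgf := integral_cosh_norm_sum_le (p := p) hXs hXl
    (by rw [integral_smul, hX0, smul_zero]) N
  have hmeas : Measurable fun y : Fin N → Y => Real.cosh ‖∑ l, lam • X (y l)‖ :=
    Real.continuous_cosh.measurable.comp (Finset.measurable_sum _ fun l _ =>
      hXs.comp (measurable_pi_apply l)).norm
  have hint : Integrable (fun y : Fin N → Y => Real.cosh ‖∑ l, lam • X (y l)‖) P := by
    refine Integrable.of_bound hmeas.aestronglyMeasurable (Real.cosh (N * (lam * B)))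
      (ae_of_all _ fun y => ?_)
    have h := norm_sum_sample_le hXl y
    rw [Real.norm_of_nonneg (Real.cosh_pos _).le]
    exact Real.cosh_le_cosh.2 (by
      rwa [abs_of_nonneg (norm_nonneg _), abs_of_nonneg ((norm_nonneg _).trans h)])
  have hsub : {y : Fin N → Y | 2 * B * Λ * Real.sqrt N ≤ ‖∑ l, X (y l)‖} ⊆
      {y | Real.exp (4 * Λ ^ 2) / 2 ≤ Real.cosh ‖∑ l, lam • X (y l)‖} := by
    intro y hy
    simp only [Set.mem_ofPred_eq] at hy ⊢
    have h1 : 4 * Λ ^ 2 ≤ ‖∑ l, lam • X (y l)‖ := by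
      rw [hsm]
      refine le_trans (le_of_eq ?_) (mul_le_mul_of_nonneg_left hy hlam0)
      rw [hlam]; field_simp; ring
    rw [Real.cosh_eq]
    have h2 := Real.exp_le_exp.2 h1
    have h3 := (Real.exp_pos (-‖∑ l, lam • X (y l)‖)).le
    linarith
  have hmarkov := mul_meas_ge_le_integral_of_nonneg (μ := P)
    (ae_of_all _ fun y => (Real.cosh_pos _).le) hint (Real.exp (4 * Λ ^ 2) / 2)
  have hpow : Real.cosh (lam * B) ^ N ≤ Real.exp (2 * Λ ^ 2) := by
    refine (pow_le_pow_left₀ (Real.cosh_pos _).le (Real.cosh_le_exp_half_sq _) N).trans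
      (le_of_eq ?_)
    rw [← Real.exp_nat_mul]
    congr 1
    rw [hlam]
    have : Real.sqrt N ^ 2 = N := Real.sq_sqrt hN0.le
    field_simp
    rw [this]
    field_simp
  have hreal : P.real {y | Real.exp (4 * Λ ^ 2) / 2 ≤ Real.cosh ‖∑ l, lam • X (y l)‖}
      ≤ 2 * Real.exp (-(2 * Λ ^ 2)) := by
    have h4 := hmarkov.trans (hmgf.trans hpow)
    have h5 : Real.exp (4 * Λ ^ 2) = Real.exp (2 * Λ ^ 2) * Real.exp (2 * Λ ^ 2) := by
      rw [← Real.exp_add]; ring_nf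
    have h6 := Real.exp_pos (2 * Λ ^ 2)
    rw [Real.exp_neg, ← div_eq_mul_inv, le_div_iff₀ h6]
    rw [h5] at h4
    have h7 : Real.exp (2 * Λ ^ 2) * (P.real {y | Real.exp (4 * Λ ^ 2) / 2 ≤
        Real.cosh ‖∑ l, lam • X (y l)‖} * Real.exp (2 * Λ ^ 2)) ≤ Real.exp (2 * Λ ^ 2) * 2 := by
      rw [h5]
      linarith
    exact le_of_mul_le_mul_left h7 h6
  refine (measure_mono hsub).trans ?_
  rw [← ENNReal.ofReal_toReal (measure_ne_top P _)]
  exact ENNReal.ofReal_le_ofReal hreal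

end Hoeffding

section ConditionalLaw

variable {Ω Ω₂ Y : Type*} [MeasurableSpace Ω] [MeasurableSpace Ω₂] [MeasurableSpace Y]

/-- `f` agrees almost surely with a measurable function of `i`. -/
def AEFactors {β : Type*} [MeasurableSpace β] (μ : Measure Ω) (i : Ω → Ω₂) (f : Ω → β) : Prop :=
  ∃ g : Ω₂ → β, Measurable g ∧ ∀ᵐ w ∂μ, f w = g (i w)

variable {μ : Measure Ω} {i : Ω → Ω₂} {y : Ω → Y} {κ : Ω → Measure Y}

lemma AEFactors.comp_seq {β β' : Type*} [MeasurableSpace β] [MeasurableSpace β'] {ι : Type*}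
    [Countable ι] {f : ι → Ω → β} (hf : ∀ n, AEFactors μ i (f n)) {Φ : (ι → β) → β'}
    (hΦ : Measurable Φ) : AEFactors μ i fun w => Φ fun n => f n w := by
  choose g hg hfg using hf
  refine ⟨fun w => Φ fun n => g n w, hΦ.comp (measurable_pi_iff.2 hg), ?_⟩
  filter_upwards [ae_all_iff.2 hfg] with w hw
  simp only [hw]

lemma AEFactors.aemeasurable {β : Type*} [MeasurableSpace β] {f : Ω → β} (hf : AEFactors μ i f)
    (hi : Measurable i) : AEMeasurable f μ := by
  obtain ⟨g, hg, hfg⟩ := hf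
  exact ⟨fun w => g (i w), hg.comp hi, hfg⟩

lemma AEFactors.of_comp {β : Type*} [MeasurableSpace β] {g : Ω₂ → β} (hg : Measurable g) :
    AEFactors μ i fun w => g (i w) := ⟨g, hg, ae_of_all _ fun _ => rfl⟩

lemma AEFactors.comp₂ {β β' β'' : Type*} [MeasurableSpace β] [MeasurableSpace β']
    [MeasurableSpace β''] {f : Ω → β} {f' : Ω → β'} (hf : AEFactors μ i f) (hf' : AEFactors μ i f')
    {Φ : β × β' → β''} (hΦ : Measurable Φ) : AEFactors μ i fun w => Φ (f w, f' w) := by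
  obtain ⟨g, hg, h⟩ := hf
  obtain ⟨g', hg', h'⟩ := hf'
  refine ⟨fun w => Φ (g w, g' w), hΦ.comp (hg.prodMk hg'), ?_⟩
  filter_upwards [h, h'] with w hw hw'
  rw [hw, hw']

variable [∀ w, IsProbabilityMeasure (κ w)]

lemma AEFactors.section_apply (hκ : ∀ B, MeasurableSet B → AEFactors μ i fun w => κ w B)
    {D : Set (Ω₂ × Y)} (hD : MeasurableSet D) :
    AEFactors μ i fun w => κ w (Prod.mk (i w) ⁻¹' D) := by
  classical
  induction D, hD using MeasurableSpace.induction_on_inter generateFrom_prod.symm isPiSystem_prod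
    with
  | empty =>
    simpa using AEFactors.of_comp (μ := μ) (i := i) (g := fun _ => (0 : ℝ≥0∞)) measurable_const
  | basic D hD =>
    obtain ⟨s, hs, t, ht, rfl⟩ := hD
    have hs : MeasurableSet s := hs
    have h := (AEFactors.of_comp (μ := μ) (i := i)
      (measurable_const.indicator hs : Measurable (s.indicator fun _ => (1 : ℝ≥0∞)))).comp₂
      (hκ t ht) (Φ := fun p => p.1 * p.2) (by fun_prop)
    refine (congrArg (AEFactors μ i) (funext fun w => ?_)).mp h
    by_cases hw : i w ∈ s <;>
      simp [hw, Set.mk_preimage_prod_right, Set.mk_preimage_prod_right_eq_empty]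
  | compl D hD ih =>
    have h := ih.comp₂ ih (Φ := fun p => 1 - p.1) (by fun_prop)
    refine (congrArg (AEFactors μ i) (funext fun w => ?_)).mp h
    rw [Set.preimage_compl, prob_compl_eq_one_sub (measurable_prodMk_left hD)]
  | iUnion f hd hf ih =>
    have h := AEFactors.comp_seq ih (Φ := fun u : ℕ → ℝ≥0∞ => ∑' n, u n)
      (Measurable.tsum fun n => measurable_pi_apply n)
    refine (congrArg (AEFactors μ i) (funext fun w => ?_)).mp h
    rw [Set.preimage_iUnion, measure_iUnion]
    · exact fun a b hab => (hd hab).preimage _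
    · exact fun n => measurable_prodMk_left (hf n)

lemma measure_joint_eq_lintegral [IsProbabilityMeasure μ] (hi : Measurable i) (hy : Measurable y)
    (hκ : ∀ B, MeasurableSet B → AEFactors μ i fun w => κ w B)
    (hR : ∀ E B, MeasurableSet E → MeasurableSet B →
      μ (i ⁻¹' E ∩ y ⁻¹' B) = ∫⁻ w in i ⁻¹' E, κ w B ∂μ)
    {D : Set (Ω₂ × Y)} (hD : MeasurableSet D) :
    μ {w | (i w, y w) ∈ D} = ∫⁻ w, κ w (Prod.mk (i w) ⁻¹' D) ∂μ := by
  classical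
  have hiy : Measurable fun w => (i w, y w) := hi.prodMk hy
  induction D, hD using MeasurableSpace.induction_on_inter generateFrom_prod.symm isPiSystem_prod
    with
  | empty => simp
  | basic D hD =>
    obtain ⟨s, hs, t, ht, rfl⟩ := hD
    have hs : MeasurableSet s := hs
    have e : {w | (i w, y w) ∈ s ×ˢ t} = i ⁻¹' s ∩ y ⁻¹' t := by ext w; simp
    rw [e, hR s t hs ht, ← lintegral_indicator (hi hs)]
    refine lintegral_congr fun w => ?_
    by_cases hw : i w ∈ s <;>
      simp [hw, Set.mk_preimage_prod_right, Set.mk_preimage_prod_right_eq_empty, Set.indicator]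
  | compl D hD ih =>
    have e : {w | (i w, y w) ∈ Dᶜ} = {w | (i w, y w) ∈ D}ᶜ := rfl
    have hD' : MeasurableSet {w | (i w, y w) ∈ D} := hiy hD
    have e2 : ∀ w, κ w (Prod.mk (i w) ⁻¹' Dᶜ) = 1 - κ w (Prod.mk (i w) ⁻¹' D) := fun w => by
      rw [Set.preimage_compl, prob_compl_eq_one_sub (measurable_prodMk_left hD)]
    rw [e, prob_compl_eq_one_sub hD', lintegral_congr e2, lintegral_sub', ih]
    · simp
    · exact (AEFactors.section_apply hκ hD).aemeasurable hi
    · rw [← ih]; exact measure_ne_top _ _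
    · exact ae_of_all _ fun w => prob_le_one
  | iUnion f hd hf ih =>
    have e : {w | (i w, y w) ∈ ⋃ n, f n} = ⋃ n, {w | (i w, y w) ∈ f n} := by
      ext w; simp
    have e2 : ∀ w, κ w (Prod.mk (i w) ⁻¹' ⋃ n, f n) = ∑' n, κ w (Prod.mk (i w) ⁻¹' f n) := by
      intro w
      rw [Set.preimage_iUnion, measure_iUnion]
      · exact fun a b hab => (hd hab).preimage _
      · exact fun n => measurable_prodMk_left (hf n)
    rw [e, measure_iUnion, lintegral_congr e2, lintegral_tsum]
    · exact tsum_congr ih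
    · exact fun n => (AEFactors.section_apply hκ (hf n)).aemeasurable hi
    · exact fun a b hab => (hd hab).preimage _
    · exact fun n => hiy (hf n)

lemma AEFactors.lintegral (hκ : ∀ B, MeasurableSet B → AEFactors μ i fun w => κ w B)
    {f : Ω₂ × Y → ℝ≥0∞} (hf : Measurable f) :
    AEFactors μ i fun w => ∫⁻ z, f (i w, z) ∂(κ w) := by
  refine Measurable.ennreal_induction
    (motive := fun f => AEFactors μ i fun w => ∫⁻ z, f (i w, z) ∂(κ w))
    (fun c s hs => ?_) (fun f g hd hf hg ihf ihg => ?_) (fun f hf hmono ih => ?_) hf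
  · have h := (AEFactors.section_apply hκ hs).comp₂ (AEFactors.section_apply hκ hs)
      (Φ := fun p => c * p.1) (by fun_prop)
    refine (congrArg (AEFactors μ i) (funext fun w => ?_)).mp h
    rw [← lintegral_indicator_const (measurable_prodMk_left hs)]
    rfl
  · have h := ihf.comp₂ ihg (Φ := fun p => p.1 + p.2) (by fun_prop)
    refine (congrArg (AEFactors μ i) (funext fun w => ?_)).mp h
    exact (lintegral_add_left (hf.comp measurable_prodMk_left) fun z => g (i w, z)).symm
  · have h := AEFactors.comp_seq ih (Φ := fun u : ℕ → ℝ≥0∞ => ⨆ n, u n)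
      (Measurable.iSup fun n => measurable_pi_apply n)
    refine (congrArg (AEFactors μ i) (funext fun w => ?_)).mp h
    exact (lintegral_iSup (fun n => (hf n).comp measurable_prodMk_left)
      fun a b hab z => hmono hab _).symm

lemma AEFactors.integral (hκ : ∀ B, MeasurableSet B → AEFactors μ i fun w => κ w B)
    {f : Ω₂ × Y → ℝ} (hf : BddMeas f) :
    AEFactors μ i fun w => ∫ z, f (i w, z) ∂(κ w) := by
  have h := (AEFactors.lintegral hκ hf.measurable.ennreal_ofReal).comp₂
    (AEFactors.lintegral hκ hf.measurable.neg.ennreal_ofReal)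
    (Φ := fun p => p.1.toReal - p.2.toReal) (by fun_prop)
  refine (congrArg (AEFactors μ i) (funext fun w => ?_)).mp h
  exact (integral_eq_lintegral_pos_part_sub_lintegral_neg_part
    ((hf.comp measurable_prodMk_left).integrable _)).symm

lemma euclidean_integral_apply {ι : Type*} [Fintype ι] {p : Measure Y}
    {F : Y → EuclideanSpace ℝ ι} (hF : Integrable F p) (j : ι) :
    (∫ z, F z ∂p) j = ∫ z, F z j ∂p :=
  ((EuclideanSpace.proj j : EuclideanSpace ℝ ι →L[ℝ] ℝ).integral_comp_comm hF).symm

lemma AEFactors.integral_euclidean {ι : Type*} [Fintype ι]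
    (hκ : ∀ B, MeasurableSet B → AEFactors μ i fun w => κ w B)
    {F : Ω₂ × Y → EuclideanSpace ℝ ι} (hF : Measurable F) {B : ℝ} (hB : ∀ z, ‖F z‖ ≤ B) :
    AEFactors μ i fun w => ∫ z, F (i w, z) ∂(κ w) := by
  have h1 : ∀ j, AEFactors μ i fun w => ∫ z, F (i w, z) j ∂(κ w) := fun j =>
    AEFactors.integral hκ (f := fun z => F z j)
      ⟨by fun_prop, B, fun z => (PiLp.norm_apply_le (F z) j).trans (hB z)⟩
  have h2 := AEFactors.comp_seq h1 (Φ := fun u : ι → ℝ => WithLp.toLp 2 u) (by fun_prop)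
  refine (congrArg (AEFactors μ i) (funext fun w => ?_)).mp h2
  ext j
  rw [euclidean_integral_apply]
  exact Integrable.of_bound (hF.comp measurable_prodMk_left).aestronglyMeasurable B
    (ae_of_all _ fun z => hB _)

/-- Conditional concentration of an i.i.d. sample mean outside of a measurable set of small
probability. -/
lemma exists_concentration_set [IsProbabilityMeasure μ] {ι : Type*} [Fintype ι] {N : ℕ}
    (hN : 1 ≤ N) {y : Ω → Fin N → Y} (hi : Measurable i) (hy : Measurable y)
    (hκ : ∀ B, MeasurableSet B → AEFactors μ i fun w => (Measure.pi fun _ : Fin N => κ w) B)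
    (hR : ∀ E B, MeasurableSet E → MeasurableSet B →
      μ (i ⁻¹' E ∩ y ⁻¹' B) = ∫⁻ w in i ⁻¹' E, (Measure.pi fun _ : Fin N => κ w) B ∂μ)
    {F : Ω₂ × Y → EuclideanSpace ℝ ι} (hF : Measurable F) {B : ℝ} (hB0 : 0 < B)
    (hB : ∀ z, ‖F z‖ ≤ B) {Λ : ℝ} (hΛ : 0 ≤ Λ) :
    ∃ V : Set Ω, MeasurableSet V ∧ μ V ≤ ENNReal.ofReal (2 * Real.exp (-(2 * Λ ^ 2))) ∧
      ∀ᵐ w ∂μ, w ∉ V →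
        ‖∑ l, (F (i w, y w l) - ∫ z, F (i w, z) ∂(κ w))‖ ≤ 4 * B * Λ * Real.sqrt N := by
  have hκ1 : ∀ B, MeasurableSet B → AEFactors μ i fun w => κ w B := by
    intro B hB
    let l0 : Fin N := ⟨0, hN⟩
    have h := hκ _ (measurable_pi_apply (X := fun _ : Fin N => Y) l0 hB)
    refine (congrArg (AEFactors μ i) (funext fun w => ?_)).mp h
    exact (measurePreserving_eval (fun _ : Fin N => κ w) l0).measure_preimage hB.nullMeasurableSet
  obtain ⟨m, hm, hmeq⟩ := AEFactors.integral_euclidean hκ1 hF hB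
  set D : Set (Ω₂ × (Fin N → Y)) :=
    {q | 2 * (2 * B) * Λ * Real.sqrt N ≤ ‖∑ l, (F (q.1, q.2 l) - m q.1)‖} with hDdef
  have hD : MeasurableSet D := by
    refine measurableSet_le measurable_const (Measurable.norm ?_)
    refine Finset.measurable_sum _ fun l _ => ?_
    exact (hF.comp (measurable_fst.prodMk ((measurable_pi_apply l).comp measurable_snd))).sub
      (hm.comp measurable_fst)
  refine ⟨{w | (i w, y w) ∈ D}, (hi.prodMk hy) hD, ?_, ?_⟩
  · rw [measure_joint_eq_lintegral (κ := fun w => Measure.pi fun _ : Fin N => κ w) hi hy hκ hR hD]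
    have hle : ∀ᵐ w ∂μ, (Measure.pi fun _ : Fin N => κ w) (Prod.mk (i w) ⁻¹' D)
        ≤ ENNReal.ofReal (2 * Real.exp (-(2 * Λ ^ 2))) := by
      filter_upwards [hmeq] with w hw
      have hFw : Measurable fun z => F (i w, z) := hF.comp measurable_prodMk_left
      have hFi : Integrable (fun z => F (i w, z)) (κ w) :=
        Integrable.of_bound hFw.aestronglyMeasurable B (ae_of_all _ fun z => hB _)
      have hmn : ‖m (i w)‖ ≤ B := by
        rw [← hw]
        have := norm_integral_le_of_norm_le_const (μ := κ w) (f := fun z => F (i w, z))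
          (ae_of_all _ fun z => hB (i w, z))
        simpa using this
      refine measure_norm_sum_ge_le (p := κ w) (X := fun z => F (i w, z) - m (i w))
        (hFw.sub_const _) (by positivity) (fun z => ?_) ?_ hN hΛ
      · exact (norm_sub_le _ _).trans (by linarith [hB (i w, z)])
      · rw [integral_sub hFi (integrable_const _), hw]
        simp
    refine (lintegral_mono_ae hle).trans ?_
    simp
  · filter_upwards [hmeq] with w hw hV
    rw [hw]
    have : ¬ (2 * (2 * B) * Λ * Real.sqrt N ≤ ‖∑ l, (F (i w, y w l) - m (i w))‖) := hV
    linarith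

end ConditionalLaw

section SubSigmaAlgebra

variable {Ω Y : Type*} {m mΩ : MeasurableSpace Ω} [MeasurableSpace Y] {μ : Measure Ω}
  {y : Ω → Y} {κ : Ω → Measure Y} [∀ w, IsProbabilityMeasure (κ w)]

lemma aeFactors_of_condExp {B : Set Y}
    (hlaw : μ⟦y ⁻¹' B | m⟧ =ᵐ[μ] fun w => (κ w).real B) :
    @AEFactors Ω Ω mΩ m ℝ≥0∞ _ μ id fun w => κ w B := by
  refine ⟨fun w => ENNReal.ofReal ((μ⟦y ⁻¹' B | m⟧) w),
    (stronglyMeasurable_condExp.measurable).ennreal_ofReal, ?_⟩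
  filter_upwards [hlaw] with w hw
  rw [id, hw, ofReal_measureReal]

variable [IsProbabilityMeasure μ]

lemma measure_inter_eq_of_condExp (hm : m ≤ mΩ) (hy : Measurable y) {B : Set Y}
    (hB : MeasurableSet B) (hlaw : μ⟦y ⁻¹' B | m⟧ =ᵐ[μ] fun w => (κ w).real B)
    {E : Set Ω} (hE : MeasurableSet[m] E) :
    μ (E ∩ y ⁻¹' B) = ∫⁻ w in E, κ w B ∂μ := by
  have hyB : MeasurableSet (y ⁻¹' B) := hy hB
  have h1 := setIntegral_condExp hm
    (f := (y ⁻¹' B).indicator fun _ => (1 : ℝ)) ((integrable_const (μ := μ) 1).indicator hyB) hE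
  have h2 : ∫ w in E, (y ⁻¹' B).indicator (fun _ => (1 : ℝ)) w ∂μ = μ.real (E ∩ y ⁻¹' B) := by
    rw [integral_indicator_const _ hyB, smul_eq_mul, mul_one, measureReal_restrict_apply hyB,
      Set.inter_comm]
  have h3 : ∫ w in E, (μ⟦y ⁻¹' B | m⟧) w ∂μ = ∫ w in E, (κ w).real B ∂μ :=
    integral_congr_ae (ae_restrict_of_ae hlaw)
  rw [h2] at h1
  have haem : AEStronglyMeasurable (fun w => (κ w).real B) μ :=
    ((stronglyMeasurable_condExp.mono hm).aestronglyMeasurable).congr hlaw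
  have h4 : ∫⁻ w in E, κ w B ∂μ = ENNReal.ofReal (∫ w in E, (κ w).real B ∂μ) := by
    rw [ofReal_integral_eq_lintegral_ofReal]
    · exact lintegral_congr fun w => by rw [ofReal_measureReal]
    · exact Integrable.of_bound haem.restrict 1 (ae_of_all _ fun w => by
        rw [Real.norm_of_nonneg measureReal_nonneg]; exact measureReal_le_one)
    · exact ae_of_all _ fun w => measureReal_nonneg
  rw [h4, ← h3, h1, ofReal_measureReal]

/-- Concentration of a sample which is i.i.d. given the past `m`. -/
lemma exists_concentration_set_of_condExp {ι : Type*} [Fintype ι] {N : ℕ} (hN : 1 ≤ N)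
    (hm : m ≤ mΩ) {y : Ω → Fin N → Y} (hy : Measurable y)
    (hlaw : ∀ B : Set (Fin N → Y), MeasurableSet B →
      μ⟦y ⁻¹' B | m⟧ =ᵐ[μ] fun w => (Measure.pi fun _ : Fin N => κ w).real B)
    {F : Ω → Y → EuclideanSpace ℝ ι}
    (hF : Measurable[m.prod inferInstance] fun q : Ω × Y => F q.1 q.2) {B : ℝ}
    (hB0 : 0 < B) (hB : ∀ w z, ‖F w z‖ ≤ B) {Λ : ℝ} (hΛ : 0 ≤ Λ) :
    ∃ V : Set Ω, MeasurableSet V ∧ μ V ≤ ENNReal.ofReal (2 * Real.exp (-(2 * Λ ^ 2))) ∧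
      ∀ᵐ w ∂μ, w ∉ V →
        ‖∑ l, (F w (y w l) - ∫ z, F w z ∂(κ w))‖ ≤ 4 * B * Λ * Real.sqrt N :=
  @exists_concentration_set Ω Ω Y mΩ m _ μ id κ _ _ ι _ N hN y (measurable_id'' hm) hy
    (fun B hB => aeFactors_of_condExp (hlaw B hB))
    (fun _ B hE hB => measure_inter_eq_of_condExp hm hy hB (hlaw B hB) hE)
    (fun q => F q.1 q.2) hF B hB0 (fun q => hB q.1 q.2) Λ hΛ

end SubSigmaAlgebra

section Algebra

variable {d : ℕ}

lemma toEuclideanLin_coord (M : Matrix (Fin d) (Fin d) ℝ) (v : Param d) (i : Fin d) :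
    Matrix.toEuclideanLin M v i = ∑ j, M i j * v j := rfl

lemma MinSingularValueGE.norm_le {G : Matrix (Fin d) (Fin d) ℝ} {σ : ℝ} (hσ : 0 ≤ σ)
    (h : MinSingularValueGE G σ) (v : Param d) : σ * ‖v‖ ≤ ‖Matrix.toEuclideanLin G v‖ := by
  set T := Matrix.toEuclideanLin G with hT
  have hn : Module.finrank ℝ (Param d) = d := finrank_euclideanSpace_fin
  set hS := T.isSymmetric_adjoint_comp_self
  set b := hS.eigenvectorBasis hn
  have h1 : ‖T v‖ ^ 2 = ∑ i, hS.eigenvalues hn i * (b.repr v i) ^ 2 := by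
    have e1 : ‖T v‖ ^ 2 = ⟪(LinearMap.adjoint T ∘ₗ T) v, v⟫ := by
      rw [LinearMap.comp_apply, LinearMap.adjoint_inner_left, real_inner_self_eq_norm_sq]
    rw [e1, ← b.sum_inner_mul_inner]
    refine Finset.sum_congr rfl fun i _ => ?_
    rw [real_inner_comm, ← b.repr_apply_apply, ← b.repr_apply_apply,
      hS.eigenvectorBasis_apply_self_apply hn v i]
    simp only [RCLike.ofReal_real_eq_id, id]
    ring
  have h2 : ‖v‖ ^ 2 = ∑ i, (b.repr v i) ^ 2 := by
    rw [← b.repr.norm_map v, EuclideanSpace.norm_sq_eq]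
    simp
  have h3 : (σ * ‖v‖) ^ 2 ≤ ‖T v‖ ^ 2 := by
    rw [mul_pow, h1, h2, Finset.mul_sum]
    refine Finset.sum_le_sum fun i _ => mul_le_mul_of_nonneg_right ?_ (sq_nonneg _)
    have := h i i.2
    rw [← T.sq_singularValues_of_lt hn i.2]
    exact pow_le_pow_left₀ hσ this 2
  exact (pow_le_pow_iff_left₀ (by positivity) (norm_nonneg _) two_ne_zero).1 h3

lemma norm_toEuclideanLin_le (M : Matrix (Fin d) (Fin d) ℝ)
    (D : EuclideanSpace ℝ (Fin d × Fin d)) (hD : ∀ i j, D (i, j) = M i j) (v : Param d) :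
    ‖Matrix.toEuclideanLin M v‖ ≤ ‖D‖ * ‖v‖ := by
  refine (pow_le_pow_iff_left₀ (norm_nonneg _) (by positivity) two_ne_zero).1 ?_
  rw [mul_pow, EuclideanSpace.norm_sq_eq, EuclideanSpace.norm_sq_eq, EuclideanSpace.norm_sq_eq,
    Fintype.sum_prod_type, Finset.sum_mul]
  refine Finset.sum_le_sum fun i _ => ?_
  simp only [toEuclideanLin_coord, Real.norm_eq_abs, sq_abs, hD]
  exact Finset.sum_mul_sq_le_sq_mul_sq _ _ _

/-- Perturbation bound for the solution of a well-conditioned linear system. -/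
lemma norm_inv_mulVec_sub_le {G A : Matrix (Fin d) (Fin d) ℝ} {n σ tx ty R : ℝ} (hn : 0 < n)
    (hσ : 0 < σ) (hG : ∀ v : Param d, σ * ‖v‖ ≤ ‖Matrix.toEuclideanLin G v‖)
    (D : EuclideanSpace ℝ (Fin d × Fin d)) (hD : ∀ i j, D (i, j) = A i j - n * G i j)
    (hDt : ‖D‖ ≤ tx) (htx : tx ≤ n * σ / 2) {b : Fin d → ℝ} {u : Param d} (hu : ‖u‖ ≤ R)
    (hb : ‖WithLp.toLp 2 b - n • Matrix.toEuclideanLin G u‖ ≤ ty) :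
    ‖WithLp.toLp 2 (A⁻¹.mulVec b) - u‖ ≤ 2 / (n * σ) * (ty + tx * R) := by
  have hAG : ∀ v : Param d, Matrix.toEuclideanLin A v
      = n • Matrix.toEuclideanLin G v + Matrix.toEuclideanLin (A - n • G) v := fun v => by
    rw [map_sub, map_smul, LinearMap.sub_apply, LinearMap.smul_apply]
    abel
  have hDv : ∀ v : Param d, ‖Matrix.toEuclideanLin (A - n • G) v‖ ≤ tx * ‖v‖ := fun v =>
    (norm_toEuclideanLin_le _ D (by simpa using hD) v).trans
      (mul_le_mul_of_nonneg_right hDt (norm_nonneg v))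
  have hAv : ∀ v : Param d, n * σ / 2 * ‖v‖ ≤ ‖Matrix.toEuclideanLin A v‖ := fun v => by
    have h1 : n * (σ * ‖v‖) ≤ ‖n • Matrix.toEuclideanLin G v‖ := by
      rw [norm_smul, Real.norm_of_nonneg hn.le]
      exact mul_le_mul_of_nonneg_left (hG v) hn.le
    have h2 := norm_sub_le_norm_add (n • Matrix.toEuclideanLin G v)
      (Matrix.toEuclideanLin (A - n • G) v)
    rw [← hAG] at h2
    have h3 := (hDv v).trans (mul_le_mul_of_nonneg_right htx (norm_nonneg v))
    linarith
  have hnσ : 0 < n * σ := mul_pos hn hσ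
  have hinj : Function.Injective A.mulVec := by
    intro v w hvw
    have h := hAv (WithLp.toLp 2 (v - w))
    have e : Matrix.toEuclideanLin A (WithLp.toLp 2 (v - w)) = 0 := by
      rw [Matrix.toLpLin_apply]
      simp only [Matrix.mulVec_sub, hvw, sub_self]
      rfl
    rw [e, norm_zero] at h
    have h0 : ‖(WithLp.toLp 2 (v - w) : Param d)‖ ≤ 0 := by
      by_contra hc
      exact absurd h (not_le.2 (mul_pos (by positivity) (not_le.1 hc)))
    have h1 : (WithLp.toLp 2 (v - w) : Param d) = 0 := norm_le_zero_iff.1 h0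
    have h2 : v - w = 0 := congrArg WithLp.ofLp h1
    exact sub_eq_zero.1 h2
  have hdet : IsUnit A.det :=
    (Matrix.isUnit_iff_isUnit_det A).1 (Matrix.mulVec_injective_iff_isUnit.1 hinj)
  have hsol : Matrix.toEuclideanLin A (WithLp.toLp 2 (A⁻¹.mulVec b)) = WithLp.toLp 2 b := by
    rw [Matrix.toLpLin_apply]
    simp only [Matrix.mulVec_mulVec, Matrix.mul_nonsing_inv A hdet, Matrix.one_mulVec]
  have h1 := hAv (WithLp.toLp 2 (A⁻¹.mulVec b) - u)
  rw [map_sub, hsol, hAG u, ← sub_sub] at h1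
  have h2 := norm_sub_le (WithLp.toLp 2 b - n • Matrix.toEuclideanLin G u)
    (Matrix.toEuclideanLin (A - n • G) u)
  have htx0 : 0 ≤ tx := (norm_nonneg D).trans hDt
  have h3 := (hDv u).trans (mul_le_mul_of_nonneg_left hu htx0)
  have h4 : n * σ / 2 * ‖WithLp.toLp 2 (A⁻¹.mulVec b) - u‖ ≤ ty + tx * R := by linarith
  rw [div_mul_eq_mul_div, le_div_iff₀ hnσ]
  linarith

lemma norm_proj_le {R : ℝ} (hR : 0 ≤ R) (x : Param d) : ‖proj R x‖ ≤ R := by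
  unfold proj
  split_ifs with h
  · exact h
  · have hx : 0 < ‖x‖ := hR.trans_lt (not_le.1 h)
    rw [norm_smul, norm_div, norm_norm, Real.norm_of_nonneg hR, div_mul_cancel₀ _ hx.ne']

lemma norm_proj_sub_le {R : ℝ} (hR : 0 ≤ R) (x : Param d) {y : Param d} (hy : ‖y‖ ≤ R) :
    ‖proj R x - y‖ ≤ ‖x - y‖ := by
  unfold proj
  split_ifs with h
  · exact le_rfl
  · have hRx := not_le.1 h
    have hx : 0 < ‖x‖ := hR.trans_lt hRx
    refine (pow_le_pow_iff_left₀ (norm_nonneg _) (norm_nonneg _) two_ne_zero).1 ?_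
    rw [norm_sub_sq_real, norm_sub_sq_real, real_inner_smul_left, norm_smul, norm_div, norm_norm,
      Real.norm_of_nonneg hR, div_mul_cancel₀ _ hx.ne']
    have hin : ⟪x, y⟫ ≤ ‖x‖ * R :=
      (real_inner_le_norm x y).trans (mul_le_mul_of_nonneg_left hy hx.le)
    have hc : 0 ≤ 1 - R / ‖x‖ := by rw [sub_nonneg, div_le_one hx]; exact hRx.le
    have h1 := mul_le_mul_of_nonneg_left hin hc
    have h2 : (1 - R / ‖x‖) * (‖x‖ * R) = ‖x‖ * R - R ^ 2 := by field_simp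
    nlinarith [sq_nonneg (‖x‖ - R)]

end Algebra

section Measurability

variable {Ω : Type*} [MeasurableSpace Ω] {d : ℕ}

lemma measurable_det {M : Ω → Matrix (Fin d) (Fin d) ℝ}
    (hM : ∀ i j, Measurable fun w => M w i j) : Measurable fun w => (M w).det := by
  simp only [Matrix.det_apply]
  exact Finset.measurable_sum _ fun σ _ =>
    (Finset.measurable_prod _ fun i _ => hM (σ i) i).const_smul _

lemma measurable_inv_apply {M : Ω → Matrix (Fin d) (Fin d) ℝ}
    (hM : ∀ i j, Measurable fun w => M w i j) (i j : Fin d) :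
    Measurable fun w => (M w)⁻¹ i j := by
  simp only [Matrix.inv_def, Matrix.smul_apply, smul_eq_mul, Ring.inverse_eq_inv',
    Matrix.adjugate_apply]
  refine (measurable_det hM).inv.mul (measurable_det fun a b => ?_)
  by_cases ha : a = j
  · subst ha
    simp
  · simpa [Matrix.updateRow_ne ha] using hM a b

lemma measurable_proj (R : ℝ) : Measurable (proj R : Param d → Param d) := by
  unfold proj
  refine Measurable.ite (measurableSet_le measurable_norm measurable_const) measurable_id ?_
  fun_prop

variable {S A : Type*} [MeasurableSpace S] [MeasurableSpace A]

lemma Feature.measurable_coord (φ : Feature S A d) (i : Fin d) :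
    Measurable fun z => φ.toFun z i := by
  have := φ.measurable_toFun
  fun_prop

lemma Feature.measurable_lin₂ (φ : Feature S A d) {ω : Ω → Param d} {f : Ω → S × A}
    (hω : Measurable ω) (hf : Measurable f) : Measurable fun w => φ.lin (ω w) (f w) := by
  have := φ.measurable_toFun.comp hf
  exact hω.inner this

lemma measurable_criticStep (M : MDP S A) (γ : ℝ) (φ : Feature S A d) {N : ℕ} {ω : Ω → Param d}
    {x : Ω → Fin N → S × A} {y : Ω → Fin N → (S × A) × (S × A)} (hω : Measurable ω)
    (hx : Measurable x) (hy : Measurable y) :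
    Measurable fun w => criticStep M γ φ (ω w) (x w) (y w) := by
  unfold criticStep
  have hyl : ∀ l, Measurable fun w => y w l := fun l => (measurable_pi_apply l).comp hy
  refine (WithLp.measurable_toLp 2 _).comp (measurable_pi_iff.2 fun i => ?_)
  simp only [Matrix.mulVec, dotProduct]
  refine Finset.measurable_sum _ fun j _ => Measurable.mul ?_ ?_
  · refine measurable_inv_apply (fun a b => ?_) i j
    simp only [Matrix.sum_apply, Matrix.vecMulVec_apply]
    refine Finset.measurable_sum _ fun l _ => ?_
    have hxl : Measurable fun w => x w l := (measurable_pi_apply l).comp hx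
    exact ((φ.measurable_coord a).comp hxl).mul ((φ.measurable_coord b).comp hxl)
  · simp only [Finset.sum_apply, Pi.smul_apply, smul_eq_mul]
    refine Finset.measurable_sum _ fun l _ => Measurable.mul ?_ ?_
    · exact ((M.measurable_r.comp (measurable_fst.comp (hyl l))).const_mul _).add
        ((φ.measurable_lin₂ hω (measurable_snd.comp (hyl l))).const_mul _)
    · exact (φ.measurable_coord j).comp (measurable_fst.comp (hyl l))

end Measurability

section CriticMean

variable {S A : Type*} [MeasurableSpace S] [MeasurableSpace A] {d : ℕ}

/-- The matrix `φ φᵀ` as a vector of the Euclidean space of matrices. -/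
def Feature.outer (φ : Feature S A d) (z : S × A) : EuclideanSpace ℝ (Fin d × Fin d) :=
  WithLp.toLp 2 fun p => φ.toFun z p.1 * φ.toFun z p.2

lemma Feature.measurable_outer (φ : Feature S A d) : Measurable φ.outer :=
  (WithLp.measurable_toLp 2 _).comp (measurable_pi_iff.2 fun p =>
    (φ.measurable_coord p.1).mul (φ.measurable_coord p.2))

lemma Feature.norm_outer_le (φ : Feature S A d) (z : S × A) : ‖φ.outer z‖ ≤ 1 := by
  have h : ‖φ.outer z‖ ^ 2 = (‖φ.toFun z‖ ^ 2) ^ 2 := by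
    rw [EuclideanSpace.norm_sq_eq, EuclideanSpace.norm_sq_eq, sq (∑ i, _), Fintype.sum_prod_type,
      Finset.sum_mul_sum]
    refine Finset.sum_congr rfl fun i _ => Finset.sum_congr rfl fun j _ => ?_
    simp only [Feature.outer, norm_mul, mul_pow]
  have h1 := φ.norm_le_one z
  have h0 := norm_nonneg (φ.toFun z)
  have h2 : (‖φ.toFun z‖ ^ 2) ^ 2 ≤ 1 := pow_le_one₀ (by positivity) (pow_le_one₀ h0 h1)
  rw [← h] at h2
  exact (sq_le_one_iff₀ (norm_nonneg _)).1 h2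

/-- The regression target times the feature vector. -/
def Feature.target (φ : Feature S A d) (M : MDP S A) (γ : ℝ) (ω : Param d)
    (q : (S × A) × (S × A)) : Param d :=
  ((1 - γ) * M.r q.1 + γ * φ.lin ω q.2) • φ.toFun q.1

variable {φ : Feature S A d} {M : MDP S A} {γ rmax R : ℝ} {ω : Param d}

lemma Feature.norm_target_le (hγ : 0 ≤ γ) (hγ1 : γ < 1) (hr : ∀ z, |M.r z| ≤ rmax)
    (hrm : 0 ≤ rmax) (hR : 0 ≤ R) (hω : ‖ω‖ ≤ R) (q : (S × A) × (S × A)) :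
    ‖φ.target M γ ω q‖ ≤ rmax + R := by
  have h1γ : 0 ≤ 1 - γ := (sub_pos.2 hγ1).le
  unfold Feature.target
  rw [norm_smul]
  have h : ‖(1 - γ) * M.r q.1 + γ * φ.lin ω q.2‖ ≤ rmax + R := by
    refine (norm_add_le _ _).trans (add_le_add ?_ ?_)
    · rw [norm_mul, Real.norm_of_nonneg h1γ]
      exact (mul_le_mul (by linarith) (hr _) (abs_nonneg _) zero_le_one).trans (one_mul _).le
    · rw [norm_mul, Real.norm_of_nonneg hγ]
      exact (mul_le_mul hγ1.le ((φ.abs_lin_le ω _).trans hω) (abs_nonneg _) zero_le_one).trans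
        (one_mul _).le
  exact (mul_le_mul h (φ.norm_le_one _) (norm_nonneg _) (by positivity)).trans (mul_one _).le

lemma Feature.cov_apply_eq (φ : Feature S A d) (p : Measure (S × A)) [IsProbabilityMeasure p]
    (i j : Fin d) : (∫ z, φ.outer z ∂p) (i, j) = φ.cov p i j := by
  rw [euclidean_integral_apply (Integrable.of_bound φ.measurable_outer.aestronglyMeasurable 1
    (ae_of_all _ φ.norm_outer_le))]
  rfl

lemma Feature.abs_coord_le (φ : Feature S A d) (z : S × A) (i : Fin d) : |φ.toFun z i| ≤ 1 :=
  (PiLp.norm_apply_le (φ.toFun z) i).trans (φ.norm_le_one z)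

lemma Feature.bddMeas_coord (φ : Feature S A d) (i : Fin d) :
    BddMeas fun z => φ.toFun z i :=
  ⟨φ.measurable_coord i, 1, fun z => φ.abs_coord_le z i⟩

lemma Feature.lin_eq_sum (φ : Feature S A d) (ω : Param d) (z : S × A) :
    φ.lin ω z = ∑ j, φ.toFun z j * ω j := by
  unfold Feature.lin
  rw [PiLp.inner_apply]
  rfl

/-- The mean of the regression target is given by the Bellman operator. -/
lemma Feature.integral_target (hr : ∀ z, |M.r z| ≤ rmax) (π : Policy S A)
    (p : Measure (S × A)) [IsProbabilityMeasure p] (i : Fin d) :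
    (∫ q, φ.target M γ ω q ∂(p ⊗ₘ M.step π)) i
      = ∫ z, M.bellman γ π (φ.lin ω) z * φ.toFun z i ∂p := by
  have hrb := M.bddMeas_r hr
  have hsc : BddMeas fun q : (S × A) × (S × A) => (1 - γ) * M.r q.1 + γ * φ.lin ω q.2 :=
    ((hrb.comp measurable_fst).const_mul _).add
      (((φ.bddMeas_lin ω).comp measurable_snd).const_mul _)
  have hcoord : BddMeas fun q : (S × A) × (S × A) =>
      ((1 - γ) * M.r q.1 + γ * φ.lin ω q.2) * φ.toFun q.1 i :=
    hsc.mul ((φ.bddMeas_coord i).comp measurable_fst)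
  obtain ⟨C, hC⟩ := hsc.bounded
  have hint : Integrable (φ.target M γ ω) (p ⊗ₘ M.step π) := by
    refine Integrable.of_bound (C := C) ?_ (ae_of_all _ fun q => ?_)
    · exact (hsc.measurable.smul
        (φ.measurable_toFun.comp measurable_fst)).aestronglyMeasurable
    · unfold Feature.target
      rw [norm_smul]
      exact (mul_le_mul (hC q) (φ.norm_le_one _) (norm_nonneg _)
        ((abs_nonneg _).trans (hC q))).trans (mul_one _).le
  rw [euclidean_integral_apply hint]
  have e : ∀ q, φ.target M γ ω q i
      = ((1 - γ) * M.r q.1 + γ * φ.lin ω q.2) * φ.toFun q.1 i := fun q => rfl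
  simp only [e]
  rw [Measure.integral_compProd (hcoord.integrable _)]
  refine integral_congr_ae (ae_of_all _ fun z => ?_)
  simp only
  rw [integral_mul_const, integral_add (integrable_const _)
    (((φ.bddMeas_lin ω).const_mul γ).integrable _), integral_const_mul γ (φ.lin ω)]
  simp only [integral_const, probReal_univ, smul_eq_mul, one_mul]
  rfl

/-- The infimum over the ball of the approximation error is attained. -/
lemma Feature.exists_realizer (φ : Feature S A d) (hR : 0 ≤ R) {f : S × A → ℝ} (hf : BddMeas f)
    (p : Measure (S × A)) [IsProbabilityMeasure p]
    (h : ⨅ u : Metric.closedBall (0 : Param d) R, ∫ z, (f z - φ.lin u z) ^ 2 ∂p = 0) :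
    ∃ u : Param d, ‖u‖ ≤ R ∧ ∀ᵐ z ∂p, f z = φ.lin u z := by
  have hsq : ∀ u : Param d, BddMeas fun z => (f z - φ.lin u z) ^ 2 := fun u => by
    simpa [sq] using (hf.sub (φ.bddMeas_lin u)).mul (hf.sub (φ.bddMeas_lin u))
  obtain ⟨C, hC⟩ := hf.bounded
  have hcont : ContinuousOn (fun u : Param d => ∫ z, (f z - φ.lin u z) ^ 2 ∂p)
      (Metric.closedBall 0 R) := by
    refine continuousOn_of_dominated (bound := fun _ => (C + R) ^ 2)
      (fun u _ => (hsq u).measurable.aestronglyMeasurable) (fun u hu => ae_of_all _ fun z => ?_)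
      (integrable_const _) (ae_of_all _ fun z => ?_)
    · rw [norm_pow]
      refine pow_le_pow_left₀ (norm_nonneg _) ((norm_sub_le _ _).trans (add_le_add (hC z) ?_)) 2
      exact (φ.abs_lin_le u z).trans (by simpa using hu)
    · unfold Feature.lin
      fun_prop
  obtain ⟨u, hu, hmin⟩ := (isCompact_closedBall (0 : Param d) R).exists_isMinOn
    ⟨0, by simpa using hR⟩ hcont
  have hz : ∫ z, (f z - φ.lin u z) ^ 2 ∂p = 0 := by
    refine le_antisymm ?_ (integral_nonneg fun z => sq_nonneg _)
    rw [← h]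
    have : Nonempty (Metric.closedBall (0 : Param d) R) := ⟨⟨u, hu⟩⟩
    exact le_ciInf fun v => hmin v.2
  refine ⟨u, by simpa using hu, ?_⟩
  rw [integral_eq_zero_iff_of_nonneg (fun z => sq_nonneg _) ((hsq u).integrable p)] at hz
  filter_upwards [hz] with z hz
  exact sub_eq_zero.1 (pow_eq_zero_iff two_ne_zero |>.1 hz)

/-- One critic step on a sample with small deviations from its mean. -/
lemma critic_error_le (hr : ∀ z, |M.r z| ≤ rmax) (hR : 0 ≤ R) (π : Policy S A)
    (p : Measure (S × A)) [IsProbabilityMeasure p] {N : ℕ} (hN : 1 ≤ N) {σ tx ty : ℝ}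
    (hσ : 0 < σ) (hG : MinSingularValueGE (φ.cov p) σ)
    (happrox : ⨅ u : Metric.closedBall (0 : Param d) R,
      ∫ z, (M.bellman γ π (φ.lin ω) z - φ.lin u z) ^ 2 ∂p = 0)
    (x : Fin N → S × A) (y : Fin N → (S × A) × (S × A))
    (hx : ‖∑ l, (φ.outer (x l) - ∫ z, φ.outer z ∂p)‖ ≤ tx) (htx : tx ≤ N * σ / 2)
    (hy : ‖∑ l, (φ.target M γ ω (y l) - ∫ q, φ.target M γ ω q ∂(p ⊗ₘ M.step π))‖ ≤ ty) :
    ∫ z, (φ.lin (proj R (criticStep M γ φ ω x y)) z - M.bellman γ π (φ.lin ω) z) ^ 2 ∂p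
      ≤ (2 / (N * σ) * (ty + tx * R)) ^ 2 := by
  have hN0 : (0 : ℝ) < N := by exact_mod_cast hN
  have hbell : BddMeas (M.bellman γ π (φ.lin ω)) :=
    M.bddMeas_bellman π (M.bddMeas_r hr) γ (φ.bddMeas_lin ω)
  obtain ⟨u, hu, hae⟩ := φ.exists_realizer hR hbell p happrox
  have hmean : ∫ q, φ.target M γ ω q ∂(p ⊗ₘ M.step π) = Matrix.toEuclideanLin (φ.cov p) u := by
    ext i
    rw [φ.integral_target hr, toEuclideanLin_coord]
    have e1 : ∫ z, M.bellman γ π (φ.lin ω) z * φ.toFun z i ∂p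
        = ∫ z, ∑ j, (φ.toFun z i * φ.toFun z j) * u j ∂p := by
      refine integral_congr_ae ?_
      filter_upwards [hae] with z hz
      rw [hz, φ.lin_eq_sum, Finset.sum_mul]
      exact Finset.sum_congr rfl fun j _ => by ring
    rw [e1, integral_finsetSum]
    · refine Finset.sum_congr rfl fun j _ => ?_
      rw [integral_mul_const]
      rfl
    · intro j _
      exact (((φ.bddMeas_coord i).mul (φ.bddMeas_coord j)).integrable p).mul_const _
  have hstep : ‖criticStep M γ φ ω x y - u‖ ≤ 2 / (N * σ) * (ty + tx * R) := by
    unfold criticStep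
    refine norm_inv_mulVec_sub_le hN0 hσ (hG.norm_le hσ.le)
      (∑ l, (φ.outer (x l) - ∫ z, φ.outer z ∂p)) (fun i j => ?_) hx htx hu ?_
    · simp only [Finset.sum_sub_distrib, Finset.sum_const, Finset.card_univ, Fintype.card_fin,
        PiLp.sub_apply, PiLp.smul_apply, nsmul_eq_mul, Matrix.sum_apply,
        Matrix.vecMulVec_apply, φ.cov_apply_eq, WithLp.ofLp_sum, Finset.sum_apply]
      rfl
    · rw [hmean, Finset.sum_sub_distrib, Finset.sum_const, Finset.card_univ, Fintype.card_fin,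
        ← Nat.cast_smul_eq_nsmul ℝ] at hy
      convert hy using 3
      rw [WithLp.toLp_sum]
      rfl
  have hproj := (norm_proj_sub_le hR (criticStep M γ φ ω x y) hu).trans hstep
  have e2 : ∫ z, (φ.lin (proj R (criticStep M γ φ ω x y)) z - M.bellman γ π (φ.lin ω) z) ^ 2 ∂p
      = ∫ z, (φ.lin (proj R (criticStep M γ φ ω x y) - u) z) ^ 2 ∂p := by
    refine integral_congr_ae ?_
    filter_upwards [hae] with z hz
    rw [hz]
    unfold Feature.lin
    rw [inner_sub_left]
  rw [e2]
  have hb := φ.bddMeas_lin (proj R (criticStep M γ φ ω x y) - u)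
  have hb2 : BddMeas fun z => (φ.lin (proj R (criticStep M γ φ ω x y) - u) z) ^ 2 := by
    simpa [sq] using hb.mul hb
  refine integral_le_of_le hb2 fun z => ?_
  rw [← sq_abs]
  exact pow_le_pow_left₀ (abs_nonneg _) ((φ.abs_lin_le _ z).trans hproj) 2

end CriticMean

section Run

variable {S A : Type*} [MeasurableSpace S] [MeasurableSpace A] {d : ℕ}

lemma Feature.measurable_target {Ω : Type*} [MeasurableSpace Ω] (φ : Feature S A d) (M : MDP S A)
    (γ : ℝ) {ω : Ω → Param d} (hω : Measurable ω) :
    Measurable fun q : Ω × ((S × A) × (S × A)) => φ.target M γ (ω q.1) q.2 := by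
  unfold Feature.target
  have h1 : Measurable fun q : Ω × ((S × A) × (S × A)) => q.2.1 :=
    measurable_fst.comp measurable_snd
  have h2 : Measurable fun q : Ω × ((S × A) × (S × A)) => q.2.2 :=
    measurable_snd.comp measurable_snd
  exact (((M.measurable_r.comp h1).const_mul _).add
    ((φ.measurable_lin₂ (hω.comp measurable_fst) h2).const_mul _)).smul
      (φ.measurable_toFun.comp h1)

lemma MDP.isProbabilityMeasure_stateAction {M : MDP S A} {π : Policy S A} {ν : Measure S}
    (h : M.IsStationary π ν) : IsProbabilityMeasure (stateAction ν π) := by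
  have := h.1
  unfold stateAction
  infer_instance

/-- With discount factor zero, all policies have the same action-value function. -/
lemma MDP.Q_zero_eq {M : MDP S A} {rmax : ℝ} (hr : ∀ z, |M.r z| ≤ rmax) (π : Policy S A)
    (z : S × A) : M.Q 0 π z = M.r z := by
  rw [← M.bellman_Q π le_rfl zero_lt_one hr, M.bellman_eq]
  simp

variable [Fintype A] [Nonempty A]

variable {Ω : Type*} {mΩ : MeasurableSpace Ω} {μ : Measure Ω} {ℱ : Filtration ℕ mΩ}
  {M : MDP S A} {γ : ℝ} {φ : Feature S A d} {ν : Policy S A → Measure S} {R β : ℝ} {K N : ℕ}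
  {θ ω : ℕ → Ω → Param d} {x : ℕ → Ω → Fin N → S × A} {y : ℕ → Ω → Fin N → (S × A) × (S × A)}

lemma IsRun.norm_critic_le (h : IsRun μ ℱ M γ φ ν R β K N θ ω x y) (hR : 0 ≤ R) {k : ℕ}
    (hk : k ≤ K + 1) (w : Ω) : ‖ω k w‖ ≤ R := by
  rcases k with _ | k
  · exact h.init_ball w
  · rw [h.critic k (by omega) w]
    exact norm_proj_le hR _

lemma IsRun.measurable_critic (h : IsRun μ ℱ M γ φ ν R β K N θ ω x y) {k : ℕ} (hk : k ≤ K + 1) :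
    Measurable[ℱ k] (ω k) := by
  induction k with
  | zero => exact h.init_critic
  | succ k ih =>
    rw [funext (h.critic k (by omega))]
    have h1 : Measurable[ℱ (k + 1)] (ω k) :=
      (ih (by omega)).mono (ℱ.mono (Nat.le_succ k)) le_rfl
    exact (measurable_proj R).comp (@measurable_criticStep Ω (ℱ (k + 1)) d S A _ _ M γ φ N _ _ _ h1
      (h.adapted_x k (by omega)) (h.adapted_y k (by omega)))

lemma IsRun.actor_smul (h : IsRun μ ℱ M γ φ ν R β K N θ ω x y) (hβ : 0 < β) {k : ℕ} (hk : k ≤ K)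
    (w : Ω) : (((k + 1 : ℕ) : ℝ) / β) • θ (k + 1) w
      = β⁻¹ • ω k w + ((k : ℝ) / β) • θ k w := by
  have e : ((k + 1 : ℕ) : ℝ) / β * (β / ((k : ℝ) + 1)) = 1 := by
    push_cast
    have : (k : ℝ) + 1 ≠ 0 := by positivity
    field_simp
  rw [h.actor k hk w, smul_smul, e, one_smul]

/-- Except on an event of small probability, all critic steps are accurate. -/
lemma IsRun.exists_critic_accurate [IsProbabilityMeasure μ] {rmax σ : ℝ}
    (h : IsRun μ ℱ M γ φ ν R β K N θ ω x y) (hγ : 0 ≤ γ) (hγ1 : γ < 1)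
    (hr : ∀ z, |M.r z| ≤ rmax) (hrm : 0 < rmax) (hR : 0 ≤ R) (hβ : 0 < β) (hN : 1 ≤ N)
    (hν : ∀ (η : ℝ) (θ : Param d), M.IsStationary (φ.policy η θ) (ν (φ.policy η θ)))
    (hzero : ZeroApproxError M γ φ ν R β K) (hσ : 0 < σ) {Λ : ℝ} (hΛ : 0 ≤ Λ)
    (hΛN : 8 * Λ ≤ σ * Real.sqrt N) :
    ∃ V : Set Ω,
      μ V ≤ (K + 1) * (2 * ENNReal.ofReal (2 * Real.exp (-(2 * Λ ^ 2)))) ∧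
      ∀ᵐ w ∂μ, w ∉ V → ∀ k ≤ K,
        let π := φ.policy (((k + 1 : ℕ) : ℝ) / β) (θ (k + 1) w)
        MinSingularValueGE (φ.cov (stateAction (ν π) π)) σ →
        ∫ z, (φ.lin (ω (k + 1) w) z - M.bellman γ π (φ.lin (ω k w)) z) ^ 2 ∂(stateAction (ν π) π)
          ≤ (8 * (rmax + 2 * R) * Λ / (σ * Real.sqrt N)) ^ 2 := by
  have hN0 : (0 : ℝ) < N := by exact_mod_cast hN
  have hsN : 0 < Real.sqrt N := Real.sqrt_pos.2 hN0
  have hsq : Real.sqrt N * Real.sqrt N = N := Real.mul_self_sqrt hN0.le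
  set π : ℕ → Ω → Policy S A := fun k w => φ.policy (((k + 1 : ℕ) : ℝ) / β) (θ (k + 1) w) with hπ
  have hp : ∀ k w, IsProbabilityMeasure (stateAction (ν (π k w)) (π k w)) := fun k w =>
    MDP.isProbabilityMeasure_stateAction (hν _ _)
  set ε := ENNReal.ofReal (2 * Real.exp (-(2 * Λ ^ 2))) with hε
  have hVx : ∀ k, ∃ V : Set Ω, k ≤ K → μ V ≤ ε ∧ ∀ᵐ w ∂μ, w ∉ V →
      ‖∑ l, (φ.outer (x k w l) - ∫ z, φ.outer z ∂(stateAction (ν (π k w)) (π k w)))‖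
        ≤ 4 * 1 * Λ * Real.sqrt N := by
    intro k
    by_cases hk : k ≤ K
    · obtain ⟨V, -, hV, hVw⟩ := exists_concentration_set_of_condExp
        (κ := fun w => stateAction (ν (π k w)) (π k w)) hN (ℱ.le k)
        ((h.adapted_x k hk).mono (ℱ.le (k + 1)) le_rfl) (h.law_x k hk) (F := fun _ z => φ.outer z)
        (φ.measurable_outer.comp (@measurable_snd Ω _ (ℱ k) _)) one_pos
        (fun _ z => φ.norm_outer_le z) hΛ
      exact ⟨V, fun _ => ⟨hV, hVw⟩⟩
    · exact ⟨∅, fun hk' => absurd hk' hk⟩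
  have hVy : ∀ k, ∃ V : Set Ω, k ≤ K → μ V ≤ ε ∧ ∀ᵐ w ∂μ, w ∉ V →
      ‖∑ l, (φ.target M γ (ω k w) (y k w l) - ∫ q, φ.target M γ (ω k w) q
          ∂(stateAction (ν (π k w)) (π k w) ⊗ₘ M.step (π k w)))‖
        ≤ 4 * (rmax + R) * Λ * Real.sqrt N := by
    intro k
    by_cases hk : k ≤ K
    · obtain ⟨V, -, hV, hVw⟩ := exists_concentration_set_of_condExp
        (κ := fun w => stateAction (ν (π k w)) (π k w) ⊗ₘ M.step (π k w)) hN (ℱ.le k)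
        ((h.adapted_y k hk).mono (ℱ.le (k + 1)) le_rfl) (h.law_y k hk)
        (F := fun w q => φ.target M γ (ω k w) q)
        (@Feature.measurable_target S A _ _ d Ω (ℱ k) φ M γ _
          (h.measurable_critic (hk.trans (Nat.le_succ K)))) (B := rmax + R) (by positivity)
        (fun w q => Feature.norm_target_le hγ hγ1 hr hrm.le hR
          (h.norm_critic_le hR (hk.trans (Nat.le_succ K)) w) q) hΛ
      exact ⟨V, fun _ => ⟨hV, hVw⟩⟩
    · exact ⟨∅, fun hk' => absurd hk' hk⟩
  choose Vx hVx using hVx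
  choose Vy hVy using hVy
  refine ⟨⋃ k ∈ Finset.range (K + 1), (Vx k ∪ Vy k), ?_, ?_⟩
  · refine (measure_biUnion_finset_le _ _).trans ?_
    refine (Finset.sum_le_sum (g := fun _ => 2 * ε) fun k hk => ?_).trans ?_
    · have hk' : k ≤ K := by have := Finset.mem_range.1 hk; omega
      refine (measure_union_le _ _).trans ?_
      rw [two_mul]
      exact add_le_add (hVx k hk').1 (hVy k hk').1
    · simp
  · have hx : ∀ᵐ w ∂μ, ∀ k, k ≤ K → w ∉ Vx k →
        ‖∑ l, (φ.outer (x k w l) - ∫ z, φ.outer z ∂(stateAction (ν (π k w)) (π k w)))‖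
        ≤ 4 * 1 * Λ * Real.sqrt N :=
      ae_all_iff.2 fun k => by
        by_cases hk : k ≤ K
        · filter_upwards [(hVx k hk).2] with w hw _ using hw
        · exact ae_of_all _ fun w hk' => absurd hk' hk
    have hy : ∀ᵐ w ∂μ, ∀ k, k ≤ K → w ∉ Vy k →
        ‖∑ l, (φ.target M γ (ω k w) (y k w l) - ∫ q, φ.target M γ (ω k w) q
          ∂(stateAction (ν (π k w)) (π k w) ⊗ₘ M.step (π k w)))‖
        ≤ 4 * (rmax + R) * Λ * Real.sqrt N :=
      ae_all_iff.2 fun k => by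
        by_cases hk : k ≤ K
        · filter_upwards [(hVy k hk).2] with w hw _ using hw
        · exact ae_of_all _ fun w hk' => absurd hk' hk
    filter_upwards [hx, hy] with w hxw hyw hwV k hk
    intro p hG
    have hwV' : w ∉ Vx k ∪ Vy k := fun hmem =>
      hwV (Set.mem_biUnion (Finset.mem_coe.2 (Finset.mem_range.2 (Nat.lt_succ_of_le hk))) hmem)
    have hxk := hxw k hk fun hm => hwV' (Or.inl hm)
    have hyk := hyw k hk fun hm => hwV' (Or.inr hm)
    have hθR : ‖θ (k + 1) w‖ ≤ R := norm_actor_le (θ := fun k => θ k w) (ω := fun k => ω k w) hβ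
      (fun j hj => h.actor_smul hβ hj w)
      (fun j hj => h.norm_critic_le hR (hj.trans (Nat.le_succ K)) w) hk
    have hz := hzero (k + 1) (by omega) (by omega) (ω k w)
      (by simpa using h.norm_critic_le hR (hk.trans (Nat.le_succ K)) w)
      (θ (k + 1) w) (by simpa using hθR)
    have := hp k w
    have hcr := critic_error_le (φ := φ) (M := M) (γ := γ) (ω := ω k w) hr hR p
      (stateAction (ν p) p) hN hσ hG hz (x k w) (y k w) hxk (by nlinarith) hyk
    rw [← h.critic k hk w] at hcr
    refine hcr.trans (le_of_eq ?_)
    congr 1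
    have hNN : (N : ℝ) = Real.sqrt N * Real.sqrt N := hsq.symm
    rw [div_mul_eq_mul_div, div_eq_div_iff (by positivity) (by positivity), hNN,
      Real.sqrt_mul_self hsN.le]
    ring

variable [MeasurableSingletonClass A]

/-- Regret of actor-critic along a trajectory of parameters with small critic errors. -/
lemma integral_sum_gap_le_of_critic_error {M : MDP S A} {γ rmax R β φstar e : ℝ} (hγ : 0 < γ)
    (hγ1 : γ < 1) (hr : ∀ z, |M.r z| ≤ rmax) (hrm : 0 ≤ rmax) (hR : 0 ≤ R) (hβ : 0 < β)
    (φ : Feature S A d) (πs : Policy S A) {ρ ρs : Measure (S × A)} [IsProbabilityMeasure ρ]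
    [IsProbabilityMeasure ρs] (hconc : M.Concentrable γ ρ ρs) {K : ℕ} {θ ω : ℕ → Param d}
    (hω : ∀ k ≤ K, ‖ω k‖ ≤ R)
    (hθ : ∀ k ≤ K, (((k + 1 : ℕ) : ℝ) / β) • θ (k + 1) = β⁻¹ • ω k + ((k : ℝ) / β) • θ k)
    (ρk : ℕ → Measure (S × A)) [∀ k, IsProbabilityMeasure (ρk k)] (he : 0 ≤ e)
    (hρk : ∀ k ≤ K, ConcentrableAt ρs (ρk (k + 1)) φstar)
    (herr : ∀ k ≤ K, ∫ z, (φ.lin (ω (k + 1)) z -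
      M.bellman γ (φ.policy (((k + 1 : ℕ) : ℝ) / β) (θ (k + 1))) (φ.lin (ω k)) z) ^ 2 ∂(ρk (k + 1))
        ≤ e ^ 2) :
    ∫ z, ∑ k ∈ Finset.range (K + 1),
      (M.Q γ πs z - M.Q γ (φ.policy (((k + 1 : ℕ) : ℝ) / β) (θ (k + 1))) z) ∂ρ
      ≤ γ * ((rmax + 2 * R) + β * Real.log (Fintype.card A)) / (1 - γ) +
        γ * (rmax + 2 * R) / (1 - γ) ^ 2 +
        (K + 1) * (φstar * e) * (3 * ((M.concCoeff γ ρ ρs).toReal / (1 - γ) ^ 2)) := by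
  have h1γ : 0 < 1 - γ := sub_pos.2 hγ1
  let π : ℕ → Policy S A := fun k => φ.policy ((k : ℝ) / β) (θ k)
  let q : ℕ → S × A → ℝ := fun k => φ.lin (ω k)
  have hqb : ∀ k, BddMeas (q k) := fun k => φ.bddMeas_lin _
  have hφ : 0 ≤ φstar := zero_le_one.trans (hρk 0 (Nat.zero_le K)).one_le
  have hq0 : ∀ z, |q 0 z| ≤ R := fun z => (φ.abs_lin_le _ z).trans (hω 0 (Nat.zero_le K))
  have hbell : ∀ z, -(rmax + R) ≤ M.bellman γ (π 1) (q 0) z := fun z => by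
    have h1 := abs_le.1 (hr z)
    have h2 := abs_le.1 (M.abs_op_le (π 1) hq0 z)
    rw [M.bellman_eq]
    nlinarith
  have hsum := hconc.hasSum_toReal hγ hγ1
  obtain ⟨T, T', hT0, hT, hT'0, hT', b1, b2, b3⟩ := exists_tail_sums hγ.le
    (c := fun m => (M.conc ρ ρs m).toReal) (fun m _ => ENNReal.toReal_nonneg) hsum.summable hγ.ne'
  rw [hsum.tsum_eq] at b1 b2 b3
  have hlog : 0 ≤ Real.log (Fintype.card A) :=
    Real.log_nonneg (by exact_mod_cast Fintype.card_pos)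
  have herr' : ∀ k ≤ K, ∀ m, 1 ≤ m → ∀ μ ∈ M.reach ρ m,
      ∫ z, |M.residual γ π q k z| ∂μ ≤ (M.conc ρ ρs m).toReal * (φstar * e) := by
    intro k hk m hm μ hμ
    have hk2 : ∫ z, (M.residual γ π q k z) ^ 2 ∂(ρk (k + 1)) ≤ e ^ 2 := by
      unfold MDP.residual
      exact herr k hk
    exact hconc.integral_abs_le hγ hγ1 (hρk k hk) (M.bddMeas_residual hr hqb k) he hk2 hm hμ
  have hmain := M.integral_sum_Q_sub_Q_le (ρ := ρ) (π := π) (K := K)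
    (c := fun m => (M.conc ρ ρs m).toReal)
    (η := φstar * e) (B := rmax + 2 * R) (D := β * Real.log (Fintype.card A))
    hγ.le hγ1 hr hqb πs (by positivity) (by positivity)
    (fun z => by
      have h1 := abs_le.1 (M.abs_Q_le πs hγ.le hγ1 hr z)
      have h2 := abs_le.1 (hq0 z)
      linarith)
    (fun z => by
      have h1 := abs_le.1 (hq0 z)
      have h2 := hbell z
      linarith)
    (fun n hn z => φ.regret_le M πs hβ hθ hn z)
    (fun k _ hk z => φ.policy_improvement M hβ hθ hk z)
    (by positivity) hT0 hT hT'0 hT'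
    herr'
  refine hmain.trans ?_
  have hc : 0 ≤ ((K : ℝ) + 1) * (φstar * e) := by positivity
  have := mul_le_mul_of_nonneg_left (add_le_add (add_le_add b1 b2) b3) hc
  linarith

end Run

/-- The sample size condition makes the failure probability small. -/
lemma failure_probability_le {K N : ℕ} {δ : ℝ} (hK : 8 ≤ K) (hN : 1 ≤ N) (hδ : 0 < δ)
    (hδ1 : δ < 1) : 1 ≤ Real.log (K * N / δ) ∧
      (K + 1) * (2 * (2 * Real.exp (-(2 * Real.log (K * N / δ) ^ 2)))) ≤ δ := by
  have hK' : (8 : ℝ) ≤ K := by exact_mod_cast hK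
  have hN' : (1 : ℝ) ≤ N := by exact_mod_cast hN
  have hKN : (8 : ℝ) ≤ K * N := by nlinarith
  have harg : (K : ℝ) ≤ K * N / δ := by
    rw [le_div_iff₀ hδ]
    nlinarith
  have hpos : 0 < K * N / δ := by positivity
  set Λ := Real.log (K * N / δ) with hΛ
  have h1 : 1 ≤ Λ := by
    rw [hΛ, Real.le_log_iff_exp_le hpos]
    have := Real.exp_one_lt_d9
    linarith
  refine ⟨h1, ?_⟩
  have h2 : Real.exp (-(2 * Λ ^ 2)) ≤ Real.exp (-(Λ + Λ)) :=
    Real.exp_le_exp.2 (by nlinarith)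
  have h3 : Real.exp (-(Λ + Λ)) = (δ / (K * N)) * (δ / (K * N)) := by
    rw [neg_add, Real.exp_add, Real.exp_neg, hΛ, Real.exp_log hpos, inv_div]
  have h4 : δ / (K * N) ≤ δ / K :=
    div_le_div_of_nonneg_left hδ.le (by linarith) (by nlinarith)
  have h5 : δ / (K * N) * (δ / (K * N)) ≤ (1 / K) * (δ / K) :=
    mul_le_mul (h4.trans (div_le_div_of_nonneg_right hδ1.le (by linarith))) h4 (by positivity)
      (by positivity)
  have h6 : Real.exp (-(2 * Λ ^ 2)) ≤ (1 / K) * (δ / K) := (h2.trans h3.le).trans h5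
  have h7 : (K + 1) * (2 * (2 * ((1 / K) * (δ / K)))) ≤ δ := by
    have e : (K + 1 : ℝ) * (2 * (2 * ((1 / K) * (δ / K)))) = δ * (4 * (K + 1)) / (K * K) := by
      field_simp
      ring
    rw [e, div_le_iff₀ (by positivity)]
    exact mul_le_mul_of_nonneg_left (by nlinarith) hδ.le
  refine le_trans ?_ h7
  gcongr

/-- The optimization, initialization and evaluation errors add up to order `s`. -/
lemma total_error_le {γ B a s L E : ℝ} (hγ : 0 ≤ γ) (hγ1 : γ < 1) (hB : 0 ≤ B) (ha : 0 < a)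
    (hs : 1 ≤ s) (hL : 0 ≤ L) (hE : E ≤ 8 * B / (a * s)) :
    γ * (B + s * L) / (1 - γ) + γ * B / (1 - γ) ^ 2 + (s * s + 1) * E * (3 / (1 - γ) ^ 2)
      ≤ (2 * ((1 - γ) ^ 3)⁻¹ * L + (2 * B / (1 - γ) ^ 2 + 48 * B / (a * (1 - γ) ^ 2))) * s := by
  have h1γ : 0 < 1 - γ := sub_pos.2 hγ1
  have hs0 : 0 < s := zero_lt_one.trans_le hs
  have h1 : γ / (1 - γ) ≤ 1 / (1 - γ) ^ 2 := by
    rw [div_le_div_iff₀ h1γ (by positivity)]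
    nlinarith
  have h2 : γ / (1 - γ) ≤ 2 * ((1 - γ) ^ 3)⁻¹ := by
    rw [← div_eq_mul_inv, div_le_div_iff₀ h1γ (by positivity)]
    have h3 : γ * (1 - γ) ^ 2 ≤ 1 := by nlinarith [sq_nonneg (1 - γ)]
    nlinarith
  have t1 : γ / (1 - γ) * B ≤ 1 / (1 - γ) ^ 2 * (B * s) :=
    mul_le_mul h1 (le_mul_of_one_le_right hB hs) hB (by positivity)
  have t2 : γ / (1 - γ) * (s * L) ≤ 2 * ((1 - γ) ^ 3)⁻¹ * (s * L) :=
    mul_le_mul_of_nonneg_right h2 (by positivity)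
  have t3 : γ * B / (1 - γ) ^ 2 ≤ B * s / (1 - γ) ^ 2 := by
    refine div_le_div_of_nonneg_right ?_ (by positivity)
    exact (mul_le_of_le_one_left hB hγ1.le).trans (le_mul_of_one_le_right hB hs)
  have h4 : s * s + 1 ≤ 2 * (s * s) := by nlinarith
  have t4 : (s * s + 1) * E ≤ 2 * (s * s) * (8 * B / (a * s)) :=
    (mul_le_mul_of_nonneg_left hE (by positivity)).trans
      (mul_le_mul_of_nonneg_right h4 (by positivity))
  have t5 : (s * s + 1) * E * (3 / (1 - γ) ^ 2)
      ≤ 2 * (s * s) * (8 * B / (a * s)) * (3 / (1 - γ) ^ 2) :=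
    mul_le_mul_of_nonneg_right t4 (by positivity)
  have e1 : 2 * (s * s) * (8 * B / (a * s)) * (3 / (1 - γ) ^ 2)
      = 48 * B / (a * (1 - γ) ^ 2) * s := by
    field_simp
    ring
  have e2 : γ * (B + s * L) / (1 - γ) = γ / (1 - γ) * B + γ / (1 - γ) * (s * L) := by ring
  have e3 : (2 * ((1 - γ) ^ 3)⁻¹ * L + (2 * B / (1 - γ) ^ 2 + 48 * B / (a * (1 - γ) ^ 2))) * s
      = 1 / (1 - γ) ^ 2 * (B * s) + 2 * ((1 - γ) ^ 3)⁻¹ * (s * L) + B * s / (1 - γ) ^ 2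
        + 48 * B / (a * (1 - γ) ^ 2) * s := by ring
  rw [e2, e3]
  linarith

end LinearAC

end

open LinearAC in
theorem theorem1 (γ rmax R c : ℝ) (hγ : 0 ≤ γ) (hγ1 : γ < 1) (hr : 0 < rmax) (hR : 0 < R)
    (hc : 0 < c) :
    ∃ (C : ℝ) (K₀ : ℕ),
      ∀ (S A : Type*) [MeasurableSpace S] [MeasurableSpace A] [Fintype A] [Nonempty A]
        [MeasurableSingletonClass A]
        (M : MDP S A) (_ : ∀ z, |M.r z| ≤ rmax)
        (d : ℕ) (_ : 0 < d) (φ : Feature S A d)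
        -- an optimal policy, and the stationary state distributions
        (πstar : Policy S A) (_ : M.IsOptimal γ πstar)
        (ν : Policy S A → Measure S) (_ : M.IsStationary πstar (ν πstar))
        (_ : ∀ (η : ℝ) (θ : Param d), M.IsStationary (φ.policy η θ) (ν (φ.policy η θ)))
        -- the evaluation distribution
        (ρ : Measure (S × A)) [IsProbabilityMeasure ρ]
        (_ : M.Concentrable γ ρ (stateAction (ν πstar) πstar))
        (φstar σstar : ℝ) (_ : 0 < φstar) (_ : 0 < σstar)
        (δ : ℝ) (_ : 0 < δ) (_ : δ < 1) (K N : ℕ) (_ : K₀ ≤ K) (_ : 1 ≤ N)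
        (_ : c * K * (M.concCoeff γ ρ (stateAction (ν πstar) πstar)).toReal ^ 2
            * (φstar / σstar) ^ 2 * Real.log (K * N / δ) ^ 2 ≤ N)
        (_ : ZeroApproxError M γ φ ν R (Real.sqrt K) K)
        -- a run of the algorithm
        (Ω : Type*) (mΩ : MeasurableSpace Ω) (μ : Measure Ω) [IsProbabilityMeasure μ]
        (ℱ : Filtration ℕ mΩ) (θ ω : ℕ → Ω → Param d)
        (x : ℕ → Ω → Fin N → S × A) (y : ℕ → Ω → Fin N → (S × A) × (S × A))
        (_ : IsRun μ ℱ M γ φ ν R (Real.sqrt K) K N θ ω x y)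
        (_ : ∀ᵐ w ∂μ, ∀ k : ℕ, 1 ≤ k → k ≤ K + 1 →
          let π := φ.policy (k / Real.sqrt K) (θ k w)
          ConcentrableAt (stateAction (ν πstar) πstar) (stateAction (ν π) π) φstar ∧
            MinSingularValueGE (φ.cov (stateAction (ν π) π)) σstar),
        μ {w | ¬ (∫ z, ∑ k ∈ Finset.range (K + 1),
              (M.Q γ πstar z -
                M.Q γ (φ.policy (((k + 1 : ℕ) : ℝ) / Real.sqrt K) (θ (k + 1) w)) z) ∂ρ
            ≤ (2 * ((1 - γ) ^ 3)⁻¹ * Real.log (Fintype.card A) + C) * Real.sqrt K)}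
          ≤ ENNReal.ofReal δ := by
  have h1γ : 0 < 1 - γ := sub_pos.2 hγ1
  set B : ℝ := rmax + 2 * R with hBdef
  have hB : 0 < B := by positivity
  have hsc : 0 < Real.sqrt c := Real.sqrt_pos.2 hc
  set κ : ℝ := (1 - γ) ^ 2 * γ with hκ
  set C : ℝ := 2 * B / (1 - γ) ^ 2 + 48 * B / (Real.sqrt c * (1 - γ) ^ 2) with hC
  have hC0 : 0 ≤ C := by positivity
  refine ⟨C, max 8 ⌈64 / (c * κ ^ 2)⌉₊, ?_⟩
  intro S A _ _ _ _ _ M hrb d hd φ πstar _ ν hνstar hν ρ _ hconc φstar σstar hφ hσ δ hδ hδ1 K N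
    hK hN hNc hzero Ω mΩ μ _ ℱ θ ω x y hrun hcond
  have hK8 : 8 ≤ K := (le_max_left _ _).trans hK
  have hK0 : (0 : ℝ) < K := by exact_mod_cast (by omega : 0 < K)
  have hN0 : (0 : ℝ) < N := by exact_mod_cast hN
  have hβ : 0 < Real.sqrt K := Real.sqrt_pos.2 hK0
  have hsN : 0 < Real.sqrt N := Real.sqrt_pos.2 hN0
  have hlog : 0 ≤ Real.log (Fintype.card A) :=
    Real.log_nonneg (by exact_mod_cast Fintype.card_pos)
  rcases eq_or_lt_of_le hγ with hγ0 | hγ0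
  · subst hγ0
    have hempty : {w | ¬ (∫ z, ∑ k ∈ Finset.range (K + 1), (M.Q 0 πstar z -
        M.Q 0 (φ.policy (((k + 1 : ℕ) : ℝ) / Real.sqrt K) (θ (k + 1) w)) z) ∂ρ
        ≤ (2 * ((1 - 0) ^ 3)⁻¹ * Real.log (Fintype.card A) + C) * Real.sqrt K)} = ∅ := by
      refine Set.eq_empty_of_forall_notMem fun w hw => hw ?_
      simp only [MDP.Q_zero_eq hrb, sub_self, Finset.sum_const_zero, integral_zero]
      positivity
    rw [hempty, measure_empty]
    exact zero_le
  have hκ0 : 0 < κ := by positivity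
  set ρs := stateAction (ν πstar) πstar with hρs
  have : IsProbabilityMeasure ρs := MDP.isProbabilityMeasure_stateAction hνstar
  have : Nonempty (Policy S A) := ⟨πstar⟩
  set Cc : ℝ := (M.concCoeff γ ρ ρs).toReal with hCc
  have hCcκ : κ ≤ Cc := hconc.le_concCoeff hγ0 hγ1
  have hCc0 : 0 < Cc := hκ0.trans_le hCcκ
  set Λ : ℝ := Real.log (K * N / δ) with hΛ
  obtain ⟨hΛ1, hprob⟩ := failure_probability_le hK8 hN hδ hδ1
  rw [← hΛ] at hΛ1 hprob
  have hΛ0 : 0 < Λ := zero_lt_one.trans_le hΛ1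
  set π : ℕ → Ω → Policy S A := fun k w => φ.policy ((k : ℝ) / Real.sqrt K) (θ k w) with hπ
  have hp : ∀ k w, IsProbabilityMeasure (stateAction (ν (π k w)) (π k w)) := fun k w =>
    MDP.isProbabilityMeasure_stateAction (hν _ _)
  have hsample : Real.sqrt c * Real.sqrt K * Cc * φstar * Λ ≤ σstar * Real.sqrt N := by
    refine (pow_le_pow_iff_left₀ (by positivity) (by positivity) two_ne_zero).1 ?_
    have e1 : (Real.sqrt c * Real.sqrt K * Cc * φstar * Λ) ^ 2
        = σstar ^ 2 * (c * K * Cc ^ 2 * (φstar / σstar) ^ 2 * Λ ^ 2) := by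
      simp only [mul_pow, Real.sq_sqrt hc.le, Real.sq_sqrt hK0.le, div_pow]
      field_simp
    rw [e1, mul_pow, Real.sq_sqrt hN0.le]
    exact mul_le_mul_of_nonneg_left hNc (by positivity)
  have hcK : 8 ≤ Real.sqrt c * Real.sqrt K * κ := by
    have h1 : 64 / (c * κ ^ 2) ≤ K :=
      (Nat.le_ceil _).trans (by exact_mod_cast (le_max_right _ _).trans hK)
    rw [div_le_iff₀ (by positivity)] at h1
    refine (pow_le_pow_iff_left₀ (by norm_num) (by positivity) two_ne_zero).1 ?_
    rw [mul_pow, mul_pow, Real.sq_sqrt hc.le, Real.sq_sqrt hK0.le]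
    linarith
  by_cases hφ1 : 1 ≤ φstar
  swap
  · exfalso
    obtain ⟨w, hw⟩ := hcond.exists
    exact hφ1 ((hw 1 le_rfl (by omega)).1.one_le (ρk := stateAction (ν (π 1 w)) (π 1 w)))
  have hΛN : 8 * Λ ≤ σstar * Real.sqrt N := by
    refine le_trans ?_ hsample
    have h1 : 8 ≤ Real.sqrt c * Real.sqrt K * Cc := by
      refine hcK.trans (mul_le_mul_of_nonneg_left hCcκ (by positivity))
    have h2 : 8 * 1 ≤ Real.sqrt c * Real.sqrt K * Cc * φstar :=
      mul_le_mul h1 hφ1 zero_le_one (by positivity)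
    rw [mul_one] at h2
    exact mul_le_mul_of_nonneg_right h2 hΛ0.le
  obtain ⟨V, hV, hgood⟩ := hrun.exists_critic_accurate hγ hγ1 hrb hr hR.le hβ hN hν hzero hσ
    hΛ0.le hΛN
  have hVδ : μ V ≤ ENNReal.ofReal δ := by
    refine hV.trans (le_trans (le_of_eq ?_) (ENNReal.ofReal_le_ofReal hprob))
    rw [ENNReal.ofReal_mul (p := (K : ℝ) + 1) (by positivity),
      ENNReal.ofReal_mul (p := 2) (by norm_num), ENNReal.ofReal_add hK0.le zero_le_one]
    simp
  refine le_trans (measure_mono_ae ?_) hVδ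
  filter_upwards [hgood, hcond] with w hgw hcw hbad
  by_contra hwV
  refine hbad ?_
  have hacc := hgw hwV
  set e : ℝ := 8 * B * Λ / (σstar * Real.sqrt N) with he
  have he0 : 0 ≤ e := by positivity
  have hreg := integral_sum_gap_le_of_critic_error hγ0 hγ1 hrb hr.le hR.le hβ φ πstar hconc
    (θ := fun k => θ k w) (ω := fun k => ω k w)
    (fun k hk => hrun.norm_critic_le hR.le (hk.trans (Nat.le_succ K)) w)
    (fun k hk => hrun.actor_smul hβ hk w)
    (fun k => stateAction (ν (π k w)) (π k w)) he0
    (fun k hk => (hcw (k + 1) (by omega) (by omega)).1)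
    (fun k hk => hacc k hk (hcw (k + 1) (by omega) (by omega)).2)
  refine hreg.trans ?_
  rw [← hCc]
  have hs1 : 1 ≤ Real.sqrt K := Real.one_le_sqrt.2 (by exact_mod_cast (by omega : 1 ≤ K))
  have hKs : Real.sqrt K * Real.sqrt K = K := Real.mul_self_sqrt hK0.le
  have herr : φstar * e * Cc ≤ 8 * B / (Real.sqrt c * Real.sqrt K) := by
    rw [le_div_iff₀ (by positivity), he]
    have e1 : φstar * (8 * B * Λ / (σstar * Real.sqrt N)) * Cc * (Real.sqrt c * Real.sqrt K)
        = 8 * B * ((Real.sqrt c * Real.sqrt K * Cc * φstar * Λ) / (σstar * Real.sqrt N)) := by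
      field_simp
    rw [e1]
    have h1 : (Real.sqrt c * Real.sqrt K * Cc * φstar * Λ) / (σstar * Real.sqrt N) ≤ 1 :=
      (div_le_one (by positivity)).2 hsample
    exact (mul_le_mul_of_nonneg_left h1 (by positivity)).trans (mul_one _).le
  have htot := total_error_le hγ hγ1 hB.le hsc hs1 hlog herr
  rw [hKs] at htot
  have e2 : (K + 1) * (φstar * e) * (3 * (Cc / (1 - γ) ^ 2))
      = (K + 1) * (φstar * e * Cc) * (3 / (1 - γ) ^ 2) := by ring
  rw [e2]
  exact htot
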